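/- Let $0\le q\le 1$ (with $0^0=1$) and let $\mathcal H$ be a real or complex Hilbert space with inner product $\langle\cdot,\cdot\rangle$, linear in the second argument. Write $[n]_q=1+q+\dots+q^{n-1}$ and, for $\pi\in S(n)$, $\mathrm{inv}(\pi)=\#\{(i,j):i<j,\ \pi(i)>\pi(j)\}$. The $q$-discrete Fock space $\mathcal F$ is the Hilbert space completion (after dividing out null vectors) of the algebraic full Fock space $\bigoplus_{n\ge0}\mathcal H^{\otimes n}$, where $\mathcal H^{\otimes 0}$ is spanned by the vacuum unit vector $\Omega$, for the positive semidefinite inner product $$\langle x_1\otimes\dots\otimes x_n,\;y_1\otimes\dots\otimes y_m\rangle_q=\delta_{n,m}\,q^{\binom n2}\sum_{\pi\in S(n)}q^{\mathrm{inv}(\pi)}\prod_{i=1}^n\langle x_i,y_{\pi(i)}\rangle .$$ On the dense subspace of finite-particle vectors (the image of the algebraic Fock space) let $C^+(f)$ be the creation operator $\xi\mapsto f\otimes\xi$, and let $C(f)$ be its adjoint, the annihilation operator, so that $C(f)\Omega=0$ and $$C(f)\,x_1\otimes\dots\otimes x_n=q^{n-1}\sum_{k=1}^n q^{k-1}\langle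 f,x_k\rangle\,x_1\otimes\dots\otimes\check x_k\otimes\dots\otimes x_n ;$$ let $q^N$ be multiplication by $q^n$ on $\mathcal H^{\otimes n}$, and let $\widehat G(f)=C(f)+C^+(f)$. Let $P_2(2n)$ be the set of pair partitions $\mathcal V$ of $\{1,\dots,2n\}$, with blocks written $(i,j)$, $i<j$. Let $\mathrm{cr}(\mathcal V)$ (resp. $\mathrm{pbr}(\mathcal V)$) be the number of pairs of blocks $(a,b),(c,d)$ with $a<c<b<d$ (resp. $a<c<d<b$), let $\mathrm{ip}(\mathcal V)=\sum_{(i,j)\in\mathcal V}(j-i-1)$ and $e_0(\mathcal V)=\mathrm{pbr}(\mathcal V)+2\,\mathrm{cr}(\mathcal V)$. The type I discrete $q$-Hermite polynomials are given by $h_0=1$, $h_1=x$, $x h_n=h_{n+1}+q^{n-1}[n]_q h_{n-1}$ for $n\ge1$; a type I discrete $q$-Hermite measure is a probability measure on $\mathbb R$ with finite moments of all orders for which the $h_n$ are pairwise orthogonal. Then: 1. For all $n\ge0$ and $f_1,\dots,f_{2n}\in\mathcal H$, $$\langle\Omega,\widehat G(f_1)\cdots\widehat G(f_{2n})\Omega\rangle=\sum_{\mathcal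 V\in P_2(2n)}q^{\frac12\mathrm{ip}(\mathcal V)+\mathrm{cr}(\mathcal V)}\prod_{(i,j)\in\mathcal V}\langle f_i,f_j\rangle .$$ 2. A type I discrete $q$-Hermite measure exists. Every such measure $\mu_q^I$ is the vacuum distribution of $\widehat G(f)$ for each $f\in\mathcal H$ with $\|f\|=1$, in the sense that $\langle\Omega,\widehat G(f)^k\Omega\rangle=\int x^k\,d\mu_q^I(x)$ for all $k\ge0$; and for all $n\ge0$ $$\int x^{2n}\,d\mu_q^I(x)=\langle\Omega,\widehat G(f)^{2n}\Omega\rangle=[1]_q[3]_q\cdots[2n-1]_q=\sum_{\mathcal V\in P_2(2n)}q^{e_0(\mathcal V)},$$ where moreover $e_0(\mathcal V)=\tfrac12\mathrm{ip}(\mathcal V)+\mathrm{cr}(\mathcal V)$ for every $\mathcal V\in P_2(2n)$. 3. For all $f,g\in\mathcal H$, on the finite-particle vectors, $$C(f)C^+(g)-q^2\,C^+(g)C(f)=\langle f,g\rangle\,q^N .$$ -/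

import Mathlib

noncomputable section

namespace QDiscrete

open scoped TensorProduct DirectSum ComplexOrder
open PiTensorProduct

/-! ### The algebraic full Fock space and the `q`-discrete inner product -/

/-- The number of inversions of a permutation. -/
def inv {n : ℕ} (π : Equiv.Perm (Fin n)) : ℕ :=
  (Finset.univ.filter fun p : Fin n × Fin n => p.1 < p.2 ∧ π p.2 < π p.1).card

section Kernel

variable {𝕜 H : Type*} [RCLike 𝕜] [NormedAddCommGroup H] [InnerProductSpace 𝕜 H]

/-- The number `q ^ (n choose 2) * ∑ π, q ^ inv π * ⟨x₁, y_{π 1}⟩ ⋯ ⟨xₙ, y_{π n}⟩`. -/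
def kernel (𝕜 : Type*) {H : Type*} [RCLike 𝕜] [NormedAddCommGroup H] [InnerProductSpace 𝕜 H]
    (q : ℝ) {n : ℕ} (x y : Fin n → H) : 𝕜 :=
  (q : 𝕜) ^ n.choose 2 *
    ∑ π : Equiv.Perm (Fin n), (q : 𝕜) ^ inv π * ∏ i, inner 𝕜 (x i) (y (π i))

theorem pow_inv_eq_prod {n : ℕ} (r : 𝕜) (π : Equiv.Perm (Fin n)) :
    r ^ inv π = ∏ i, ∏ j, if i < j ∧ π j < π i then r else 1 := by
  rw [← Finset.prod_product', inv, Finset.prod_ite]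
  simp

theorem inv_symm {n : ℕ} (π : Equiv.Perm (Fin n)) : inv π.symm = inv π := by
  unfold inv
  refine Finset.card_bij' (fun p _ => (π.symm p.2, π.symm p.1)) (fun p _ => (π p.2, π p.1))
    ?_ ?_ ?_ ?_ <;> simp +contextual

theorem kernel_conj (q : ℝ) {n : ℕ} (x y : Fin n → H) :
    (starRingEnd 𝕜) (kernel 𝕜 q y x) = kernel 𝕜 q x y := by
  simp only [kernel, map_mul, map_pow, RCLike.conj_ofReal, map_sum, map_prod, inner_conj_symm]
  congr 1
  rw [← Equiv.sum_comp (Equiv.inv (Equiv.Perm (Fin n)))]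
  refine Finset.sum_congr rfl fun π _ => ?_
  simp only [Equiv.inv_apply]
  congr 1
  · rw [show (π⁻¹ : Equiv.Perm (Fin n)) = π.symm from rfl, inv_symm]
  · rw [← Equiv.prod_comp π]
    simp

theorem kernel_update_add (q : ℝ) {n : ℕ} (x y : Fin n → H) (k : Fin n) (a b : H) :
    kernel 𝕜 q x (Function.update y k (a + b)) =
      kernel 𝕜 q x (Function.update y k a) + kernel 𝕜 q x (Function.update y k b) := by
  simp only [kernel, ← mul_add, ← Finset.sum_add_distrib]
  congr 1
  refine Finset.sum_congr rfl fun π _ => ?_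
  congr 1
  simp only [← Equiv.prod_comp π.symm (fun i => inner 𝕜 (x i) _), Equiv.apply_symm_apply]
  simp only [← Finset.mul_prod_erase Finset.univ _ (Finset.mem_univ k), Function.update_self,
    inner_add_right, add_mul]
  congr 2 <;>
  · refine Finset.prod_congr rfl fun i hi => ?_
    simp [Function.update_of_ne (Finset.ne_of_mem_erase hi)]

theorem kernel_update_smul (q : ℝ) {n : ℕ} (x y : Fin n → H) (k : Fin n) (c : 𝕜) (a : H) :
    kernel 𝕜 q x (Function.update y k (c • a)) = c * kernel 𝕜 q x (Function.update y k a) := by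
  simp only [kernel, mul_left_comm c, Finset.mul_sum]
  refine Finset.sum_congr rfl fun π _ => ?_
  congr 2
  simp only [← Equiv.prod_comp π.symm (fun i => inner 𝕜 (x i) _), Equiv.apply_symm_apply]
  simp only [← Finset.mul_prod_erase Finset.univ _ (Finset.mem_univ k), Function.update_self,
    inner_smul_right, mul_assoc]
  congr 2
  refine Finset.prod_congr rfl fun i hi => ?_
  simp [Function.update_of_ne (Finset.ne_of_mem_erase hi)]

/-- The kernel as a multilinear map in its second argument. -/
def kernelRight (q : ℝ) {n : ℕ} (x : Fin n → H) : MultilinearMap 𝕜 (fun _ : Fin n => H) 𝕜 :=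
  MultilinearMap.mk' (fun y => kernel 𝕜 q x y)
    (fun y k a b => by convert kernel_update_add q x y k a b)
    (fun y k c a => by rw [smul_eq_mul]; convert kernel_update_smul q x y k c a)

/-- For fixed `ξ`, the map `y ↦ ⟨ξ, y₁ ⊗ ⋯ ⊗ yₙ⟩`; it is multilinear. -/
def formLeft (q : ℝ) {n : ℕ} (ξ : ⨂[𝕜]^n H) : MultilinearMap 𝕜 (fun _ : Fin n => H) 𝕜 :=
  MultilinearMap.mk' (fun y => (starRingEnd 𝕜) (lift (kernelRight q y) ξ))
    (fun y k a b => by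
      induction ξ using PiTensorProduct.induction_on with
      | smul_tprod r x =>
        simp [kernelRight, kernel_conj, kernel_update_add, mul_add]
      | add ξ η h₁ h₂ => simp only [map_add, h₁, h₂]; ring)
    (fun y k c a => by
      induction ξ using PiTensorProduct.induction_on with
      | smul_tprod r x =>
        simp [kernelRight, kernel_conj, kernel_update_smul, mul_left_comm]
      | add ξ η h₁ h₂ => simp only [map_add, h₁, h₂, smul_add])

/-- The `q`-discrete sesquilinear form on `H^{⊗ n}`, conjugate linear in the first argument. It is
characterized by `form_tprod`. -/
def form (q : ℝ) {n : ℕ} : (⨂[𝕜]^n H) →ₗ⋆[𝕜] (⨂[𝕜]^n H) →ₗ[𝕜] 𝕜 where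
  toFun ξ := lift (formLeft q ξ)
  map_add' ξ η := by
    ext y
    simp [formLeft]
  map_smul' c ξ := by
    ext y
    simp [formLeft]

@[simp]
theorem form_tprod (q : ℝ) {n : ℕ} (x y : Fin n → H) :
    form q (tprod 𝕜 x) (tprod 𝕜 y) = kernel 𝕜 q x y := by
  simp [form, formLeft, kernelRight, kernel_conj]

theorem form_conj (q : ℝ) {n : ℕ} (ξ η : ⨂[𝕜]^n H) :
    (starRingEnd 𝕜) (form q η ξ) = form q ξ η := by
  induction ξ using PiTensorProduct.induction_on with
  | add ξ ξ' h₁ h₂ => simp [h₁, h₂]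
  | smul_tprod r x =>
    induction η using PiTensorProduct.induction_on with
    | add η η' h₁ h₂ => simp only [map_add, LinearMap.add_apply, h₁, h₂]
    | smul_tprod r' y => simp [kernel_conj, mul_left_comm]

theorem pow_inv_mul {q : ℝ} (hq : 0 ≤ q) {n : ℕ} (σ τ : Equiv.Perm (Fin n)) :
    (q : 𝕜) ^ inv (τ * σ⁻¹) =
      ∏ i, ∏ j, if (decide (σ i < σ j)) = (decide (τ i < τ j)) then 1 else ((√q : ℝ) : 𝕜) := by
  have hs : ((√q : ℝ) : 𝕜) * ((√q : ℝ) : 𝕜) = (q : 𝕜) := by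
    rw [← RCLike.ofReal_mul, Real.mul_self_sqrt hq]
  have key : ∀ r : 𝕜, r ^ inv (τ * σ⁻¹) =
      ∏ i, ∏ j, if σ i < σ j ∧ τ j < τ i then r else 1 := by
    intro r
    rw [pow_inv_eq_prod, ← Equiv.prod_comp σ]
    refine Finset.prod_congr rfl fun i _ => ?_
    rw [← Equiv.prod_comp σ]
    simp
  rw [← hs, mul_pow]
  refine (congrArg₂ (· * ·) (key _) ((key _).trans Finset.prod_comm)).trans ?_
  simp only [← Finset.prod_mul_distrib]
  refine Finset.prod_congr rfl fun i _ => Finset.prod_congr rfl fun j _ => ?_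
  rcases eq_or_ne i j with rfl | h
  · simp
  · have h1 : σ i ≠ σ j := fun e => h (σ.injective e)
    have h2 : τ i ≠ τ j := fun e => h (τ.injective e)
    rcases lt_or_gt_of_ne h1 with h1 | h1 <;> rcases lt_or_gt_of_ne h2 with h2 | h2 <;>
      simp [h1, h2, h1.not_gt, h2.not_gt]

theorem posSemidef_comparison {X : Type*} {r : ℝ} (h0 : 0 ≤ r) (h1 : r ≤ 1) (b : X → Bool) :
    (Matrix.of fun s t : X => if b s = b t then (1 : 𝕜) else (r : 𝕜)).PosSemidef := by
  have hB : ((1 : Matrix Bool Bool 𝕜).submatrix b b).PosSemidef :=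
    Matrix.PosSemidef.one.submatrix b
  have hU : ((1 : Matrix Unit Unit 𝕜).submatrix (fun _ : X => ()) (fun _ : X => ())).PosSemidef :=
    Matrix.PosSemidef.one.submatrix _
  have h0' : (0 : 𝕜) ≤ (r : 𝕜) := by exact_mod_cast h0
  have h1' : (0 : 𝕜) ≤ ((1 - r : ℝ) : 𝕜) := by exact_mod_cast sub_nonneg.2 h1
  convert (hB.smul h1').add (hU.smul h0') using 1
  ext s t
  by_cases h : b s = b t <;> simp [h, Matrix.one_apply, RCLike.real_smul_eq_coe_mul]

theorem posSemidef_prod {X ι : Type*} (s : Finset ι) (M : ι → Matrix X X 𝕜)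
    (hM : ∀ i ∈ s, (M i).PosSemidef) :
    (Matrix.of fun a b => ∏ i ∈ s, M i a b).PosSemidef := by
  classical
  induction s using Finset.induction_on with
  | empty =>
    convert (Matrix.PosSemidef.one (n := Unit) (R := 𝕜)).submatrix (fun _ : X => ()) using 1
    ext a b
    simp
  | insert i s hi ih =>
    convert (hM i (Finset.mem_insert_self i s)).hadamard
      (ih fun j hj => hM j (Finset.mem_insert_of_mem hj)) using 1
    ext a b
    simp [Finset.prod_insert hi, Matrix.hadamard_apply]

theorem kernel_average {q : ℝ} (hq : 0 ≤ q) {n : ℕ} (x y : Fin n → H) :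
    (n.factorial : 𝕜) * kernel 𝕜 q x y = (q : 𝕜) ^ n.choose 2 *
      ∑ σ : Equiv.Perm (Fin n), ∑ τ : Equiv.Perm (Fin n),
        (∏ i, ∏ j, if (decide (σ i < σ j)) = (decide (τ i < τ j)) then 1 else ((√q : ℝ) : 𝕜)) *
          ∏ i, inner 𝕜 (x (σ i)) (y (τ i)) := by
  have h : ∀ σ : Equiv.Perm (Fin n), ∑ τ : Equiv.Perm (Fin n),
        (∏ i, ∏ j, if (decide (σ i < σ j)) = (decide (τ i < τ j)) then 1 else ((√q : ℝ) : 𝕜)) *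
          ∏ i, inner 𝕜 (x (σ i)) (y (τ i)) =
      ∑ π : Equiv.Perm (Fin n), (q : 𝕜) ^ inv π * ∏ i, inner 𝕜 (x i) (y (π i)) := by
    intro σ
    rw [← Equiv.sum_comp (Equiv.mulRight σ⁻¹) (fun π => (q : 𝕜) ^ inv π * _)]
    refine Finset.sum_congr rfl fun τ _ => ?_
    rw [← pow_inv_mul hq]
    simp only [Equiv.coe_mulRight]
    congr 1
    rw [← Equiv.prod_comp σ (fun i => inner 𝕜 (x i) _)]
    simp
  simp only [h, Finset.sum_const, Finset.card_univ, Fintype.card_perm, Fintype.card_fin, kernel,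
    nsmul_eq_mul]
  ring

theorem form_self_nonneg {q : ℝ} (h0 : 0 ≤ q) (h1 : q ≤ 1) {n : ℕ} (ξ : ⨂[𝕜]^n H) :
    0 ≤ form q ξ ξ := by
  obtain ⟨c, rfl⟩ : ∃ c : (Fin n → H) →₀ 𝕜, (c.sum fun x a => a • tprod 𝕜 x) = ξ := by
    rw [← Finsupp.mem_span_range_iff_exists_finsupp, PiTensorProduct.span_tprod_eq_top]
    trivial
  have hr : √q ≤ 1 := Real.sqrt_le_one.2 h1
  have hK : (Matrix.of fun s t : c.support × Equiv.Perm (Fin n) =>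
      (∏ i, ∏ j, if (decide (s.2 i < s.2 j)) = (decide (t.2 i < t.2 j)) then 1
        else ((√q : ℝ) : 𝕜)) * ∏ i, inner 𝕜 (s.1.1 (s.2 i)) (t.1.1 (t.2 i))).PosSemidef := by
    refine Matrix.PosSemidef.hadamard
      (A := Matrix.of fun s t : c.support × Equiv.Perm (Fin n) =>
        ∏ i, ∏ j, if (decide (s.2 i < s.2 j)) = (decide (t.2 i < t.2 j)) then 1
          else ((√q : ℝ) : 𝕜))
      (B := Matrix.of fun s t : c.support × Equiv.Perm (Fin n) =>
        ∏ i, inner 𝕜 (s.1.1 (s.2 i)) (t.1.1 (t.2 i))) ?_ ?_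
    · exact posSemidef_prod Finset.univ _ fun i _ => posSemidef_prod Finset.univ _ fun j _ =>
        posSemidef_comparison (Real.sqrt_nonneg q) hr
          fun s : c.support × Equiv.Perm (Fin n) => decide (s.2 i < s.2 j)
    · exact posSemidef_prod Finset.univ _ fun i _ => Matrix.posSemidef_gram 𝕜
        fun s : c.support × Equiv.Perm (Fin n) => s.1.1 (s.2 i)
  have hnn := hK.dotProduct_mulVec_nonneg (fun p => c p.1)
  have hfac : (0 : 𝕜) ≤ (((n.factorial : ℝ)⁻¹ : ℝ) : 𝕜) := by
    exact_mod_cast inv_nonneg.2 (Nat.cast_nonneg _)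
  have hne : (n.factorial : 𝕜) ≠ 0 := by exact_mod_cast n.factorial_ne_zero
  have hqn : (0 : 𝕜) ≤ (q : 𝕜) ^ n.choose 2 := by
    rw [← RCLike.ofReal_pow]; exact_mod_cast pow_nonneg h0 _
  have hform : form q (c.sum fun x a => a • tprod 𝕜 x) (c.sum fun x a => a • tprod 𝕜 x) =
      ∑ x : c.support, ∑ y : c.support,
        (starRingEnd 𝕜) (c x) * (c y * kernel 𝕜 q (x : Fin n → H) (y : Fin n → H)) := by
    have hc : (c.sum fun x a => a • tprod 𝕜 x) =
        ∑ x : c.support, c x • tprod 𝕜 (x : Fin n → H) :=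
      (Finset.sum_coe_sort c.support fun x => c x • tprod 𝕜 x).symm
    simp only [hc, map_sum, LinearMap.sum_apply, LinearMap.map_smulₛₗ, LinearMap.smul_apply,
      form_tprod, smul_eq_mul, RingHom.id_apply]
    rw [Finset.sum_comm]
    simp only [Finset.mul_sum, mul_left_comm]
  convert mul_nonneg hfac (mul_nonneg hqn hnn) using 1
  rw [RCLike.ofReal_inv, RCLike.ofReal_natCast, eq_inv_mul_iff_mul_eq₀ hne, hform]
  simp only [dotProduct, Matrix.mulVec, Fintype.sum_prod_type, Pi.star_apply, Matrix.of_apply,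
    Finset.mul_sum, mul_left_comm (n.factorial : 𝕜), kernel_average h0]
  refine Finset.sum_congr rfl fun x _ => ?_
  rw [Finset.sum_comm]
  refine Finset.sum_congr rfl fun σ _ => ?_
  refine Finset.sum_congr rfl fun y _ => ?_
  refine Finset.sum_congr rfl fun τ _ => ?_
  simp only [RCLike.star_def]
  ring

/-! #### The adjoint pair -/

/-- The permutation of `{0, …, n}` that sends `0` to `k` and the rest by `σ`. -/
def insertPerm {n : ℕ} (p : Fin (n + 1) × Equiv.Perm (Fin n)) : Equiv.Perm (Fin (n + 1)) :=
  (finSuccEquiv' 0).trans ((Equiv.optionCongr p.2).trans (finSuccEquiv' p.1).symm)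

theorem insertPerm_zero {n : ℕ} (p : Fin (n + 1) × Equiv.Perm (Fin n)) :
    insertPerm p 0 = p.1 := by
  simp [insertPerm]

theorem insertPerm_succ {n : ℕ} (p : Fin (n + 1) × Equiv.Perm (Fin n)) (i : Fin n) :
    insertPerm p i.succ = p.1.succAbove (p.2 i) := by
  have : finSuccEquiv' (0 : Fin (n + 1)) i.succ = some i := by
    rw [← Fin.succAbove_zero_apply, finSuccEquiv'_succAbove]
  simp [insertPerm, this]

theorem insertPerm_bijective (n : ℕ) : Function.Bijective (insertPerm (n := n)) := by
  rw [Fintype.bijective_iff_injective_and_card]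
  constructor
  · rintro ⟨k, σ⟩ ⟨l, τ⟩ h
    have hk : k = l := by
      have := congrArg (fun π => π 0) h
      simpa [insertPerm_zero] using this
    subst hk
    congr 1
    ext i
    have := congrArg (fun π => π i.succ) h
    simp only [insertPerm_succ] at this
    rw [Fin.succAbove_right_injective this]
  · simp [Fintype.card_perm, Nat.factorial_succ]

theorem pow_inv_insertPerm {n : ℕ} (r : 𝕜) (p : Fin (n + 1) × Equiv.Perm (Fin n)) :
    r ^ inv (insertPerm p) = r ^ (p.1 : ℕ) * r ^ inv p.2 := by
  rw [pow_inv_eq_prod, pow_inv_eq_prod, Fin.prod_univ_succ]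
  congr 1
  · rw [Fin.prod_univ_succ]
    simp only [insertPerm_zero, insertPerm_succ, lt_irrefl, false_and, if_false, one_mul,
      Fin.succ_pos, true_and]
    rw [Equiv.prod_comp p.2 (fun j => if p.1.succAbove j < p.1 then r else 1)]
    simp only [Fin.succAbove_lt_iff_castSucc_lt]
    rw [Finset.prod_ite]
    simp only [Finset.prod_const, one_pow, mul_one]
    congr 1
    have hlt : (p.1 : ℕ) ≤ n := Nat.lt_succ_iff.1 p.1.isLt
    simp only [Fin.lt_def, Fin.val_castSucc]
    rw [Fin.card_filter_val_lt, min_eq_right hlt]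
  · refine Finset.prod_congr rfl fun i _ => ?_
    rw [Fin.prod_univ_succ]
    simp [insertPerm_succ, (Fin.strictMono_succAbove p.1).lt_iff_lt]

theorem kernel_cons (q : ℝ) {n : ℕ} (f : H) (x : Fin n → H) (y : Fin (n + 1) → H) :
    kernel 𝕜 q (Fin.cons f x : Fin (n + 1) → H) y =
      (q : 𝕜) ^ n * ∑ k : Fin (n + 1), (q : 𝕜) ^ (k : ℕ) * inner 𝕜 f (y k) *
        kernel 𝕜 q x (k.removeNth y) := by
  have hc : (n + 1).choose 2 = n + n.choose 2 := by
    rw [Nat.choose_succ_succ' n 1, Nat.choose_one_right]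
  unfold kernel
  rw [← (insertPerm_bijective n).sum_comp, Fintype.sum_prod_type, hc, pow_add, mul_assoc]
  congr 1
  rw [Finset.mul_sum]
  refine Finset.sum_congr rfl fun k _ => ?_
  simp only [Finset.mul_sum]
  refine Finset.sum_congr rfl fun σ _ => ?_
  rw [pow_inv_insertPerm, Fin.prod_univ_succ]
  simp only [insertPerm_zero, insertPerm_succ, Fin.cons_zero, Fin.cons_succ, Fin.removeNth]
  ring

end Kernel

section Fock

variable (𝕜 H : Type*) [RCLike 𝕜] [NormedAddCommGroup H] [InnerProductSpace 𝕜 H]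

/-- The algebraic full Fock space `⨁ₙ H^{⊗ n}`. The parameter `q ∈ [0, 1]` only selects the inner
product that this space carries. -/
def PreFock (_q : unitInterval) : Type _ := ⨁ n : ℕ, ⨂[𝕜]^n H

instance (q : unitInterval) : AddCommGroup (PreFock 𝕜 H q) :=
  inferInstanceAs (AddCommGroup (⨁ n : ℕ, ⨂[𝕜]^n H))

/-- The vector space structure of the algebraic Fock space, kept as a definition because the
instance is obtained from the inner product space structure below. -/
abbrev PreFock.module (q : unitInterval) : Module 𝕜 (PreFock 𝕜 H q) :=
  inferInstanceAs (Module 𝕜 (⨁ n : ℕ, ⨂[𝕜]^n H))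

variable {𝕜 H}

/-- The `q`-discrete form on the algebraic Fock space: different particle numbers are
orthogonal, and on `H^{⊗ n}` it is `form`. -/
def preForm (q : ℝ) (ξ η : ⨁ n : ℕ, ⨂[𝕜]^n H) : 𝕜 :=
  DirectSum.toModule 𝕜 ℕ 𝕜 (fun n => form q (ξ n)) η

theorem preForm_lof_right (q : ℝ) (ξ : ⨁ n : ℕ, ⨂[𝕜]^n H) (n : ℕ) (η : ⨂[𝕜]^n H) :
    preForm q ξ (DirectSum.lof 𝕜 ℕ (fun n => ⨂[𝕜]^n H) n η) = form q (ξ n) η := by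
  simp [preForm]

theorem preForm_add_right (q : ℝ) (ξ η η' : ⨁ n : ℕ, ⨂[𝕜]^n H) :
    preForm q ξ (η + η') = preForm q ξ η + preForm q ξ η' := by
  simp [preForm]

theorem preForm_add_left (q : ℝ) (ξ ξ' η : ⨁ n : ℕ, ⨂[𝕜]^n H) :
    preForm q (ξ + ξ') η = preForm q ξ η + preForm q ξ' η := by
  induction η using DirectSum.induction_on with
  | zero => simp [preForm]
  | of n η => simp [← DirectSum.lof_eq_of 𝕜, preForm_lof_right]
  | add η η' h h' => simp only [preForm_add_right, h, h']; ring

theorem preForm_smul_left (q : ℝ) (c : 𝕜) (ξ η : ⨁ n : ℕ, ⨂[𝕜]^n H) :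
    preForm q (c • ξ) η = (starRingEnd 𝕜) c * preForm q ξ η := by
  induction η using DirectSum.induction_on with
  | zero => simp [preForm]
  | of n η => simp [← DirectSum.lof_eq_of 𝕜, preForm_lof_right, DirectSum.smul_apply]
  | add η η' h h' => simp only [preForm_add_right, h, h']; ring

theorem preForm_eq_sum (q : ℝ) (ξ η : ⨁ n : ℕ, ⨂[𝕜]^n H) :
    ∃ s : Finset ℕ, ∀ t : Finset ℕ, s ⊆ t → preForm q ξ η = ∑ n ∈ t, form q (ξ n) (η n) := by
  induction η using DirectSum.induction_on with
  | zero => exact ⟨∅, by simp [preForm]⟩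
  | of n η =>
    refine ⟨{n}, fun t ht => ?_⟩
    rw [← DirectSum.lof_eq_of 𝕜, preForm_lof_right, Finset.sum_eq_single n]
    · simp
    · intro m _ hm
      rw [DirectSum.lof_eq_of, DirectSum.of_eq_of_ne _ _ _ hm, map_zero]
    · exact fun h => absurd (ht (Finset.mem_singleton_self n)) h
  | add η η' h h' =>
    obtain ⟨s, hs⟩ := h
    obtain ⟨s', hs'⟩ := h'
    refine ⟨s ∪ s', fun t ht => ?_⟩
    rw [preForm_add_right, hs t (Finset.union_subset_left ht),
      hs' t (Finset.union_subset_right ht), ← Finset.sum_add_distrib]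
    simp

theorem preForm_conj (q : ℝ) (ξ η : ⨁ n : ℕ, ⨂[𝕜]^n H) :
    (starRingEnd 𝕜) (preForm q η ξ) = preForm q ξ η := by
  obtain ⟨s, hs⟩ := preForm_eq_sum q ξ η
  obtain ⟨s', hs'⟩ := preForm_eq_sum q η ξ
  rw [hs (s ∪ s') Finset.subset_union_left, hs' (s ∪ s') Finset.subset_union_right, map_sum]
  simp only [form_conj]

theorem preForm_self_nonneg {q : ℝ} (h0 : 0 ≤ q) (h1 : q ≤ 1) (ξ : ⨁ n : ℕ, ⨂[𝕜]^n H) :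
    0 ≤ preForm q ξ ξ := by
  obtain ⟨s, hs⟩ := preForm_eq_sum q ξ ξ
  rw [hs s subset_rfl]
  exact Finset.sum_nonneg fun n _ => form_self_nonneg h0 h1 _

/-- The positive semidefinite `q`-discrete inner product on the algebraic Fock space. -/
abbrev preFockCore (q : unitInterval) :
    @PreInnerProductSpace.Core 𝕜 (PreFock 𝕜 H q) _ _ (PreFock.module 𝕜 H q) :=
  letI := PreFock.module 𝕜 H q
  { inner := fun ξ η => preForm (q : ℝ) ξ η
    conj_inner_symm := preForm_conj (q : ℝ)
    re_inner_nonneg := fun ξ =>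
      (RCLike.nonneg_iff.1 (preForm_self_nonneg q.2.1 q.2.2 ξ)).1
    add_left := preForm_add_left (q : ℝ)
    smul_left := fun ξ η c => preForm_smul_left (q : ℝ) c ξ η }

instance (q : unitInterval) : SeminormedAddCommGroup (PreFock 𝕜 H q) :=
  letI := PreFock.module 𝕜 H q
  letI := preFockCore (𝕜 := 𝕜) (H := H) q
  InnerProductSpace.Core.toSeminormedAddCommGroup (𝕜 := 𝕜)

instance (q : unitInterval) : InnerProductSpace 𝕜 (PreFock 𝕜 H q) :=
  letI := PreFock.module 𝕜 H q
  InnerProductSpace.ofCore (preFockCore q)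

theorem inner_preFock (q : unitInterval) (ξ η : PreFock 𝕜 H q) :
    inner 𝕜 ξ η = preForm (q : ℝ) ξ η := rfl

variable (𝕜 H) in
/-- The inclusion of `H^{⊗ n}` into the algebraic Fock space. -/
def incl (q : unitInterval) (n : ℕ) : (⨂[𝕜]^n H) →ₗ[𝕜] PreFock 𝕜 H q :=
  DirectSum.lof 𝕜 ℕ (fun n => ⨂[𝕜]^n H) n

variable (𝕜 H) in
/-- The linear map out of the algebraic Fock space with given restrictions to `H^{⊗ n}`. -/
def fromLevels (q : unitInterval) {M : Type*} [AddCommGroup M] [Module 𝕜 M]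
    (φ : ∀ n : ℕ, (⨂[𝕜]^n H) →ₗ[𝕜] M) : PreFock 𝕜 H q →ₗ[𝕜] M :=
  DirectSum.toModule 𝕜 ℕ M φ

theorem fromLevels_incl (q : unitInterval) {M : Type*} [AddCommGroup M] [Module 𝕜 M]
    (φ : ∀ n : ℕ, (⨂[𝕜]^n H) →ₗ[𝕜] M) (n : ℕ) (ξ : ⨂[𝕜]^n H) :
    fromLevels 𝕜 H q φ (incl 𝕜 H q n ξ) = φ n ξ :=
  DirectSum.toModule_lof (M := fun n => ⨂[𝕜]^n H) (φ := φ) 𝕜 n ξ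

theorem preFock_induction {q : unitInterval} {P : PreFock 𝕜 H q → Prop} (ξ : PreFock 𝕜 H q)
    (htprod : ∀ (n : ℕ) (c : 𝕜) (x : Fin n → H), P (c • incl 𝕜 H q n (tprod 𝕜 x)))
    (hadd : ∀ ξ η, P ξ → P η → P (ξ + η)) : P ξ := by
  have hincl : ∀ (n : ℕ) (ξ : ⨂[𝕜]^n H), P (incl 𝕜 H q n ξ) := by
    intro n ξ
    induction ξ using PiTensorProduct.induction_on with
    | smul_tprod c x => rw [map_smul]; exact htprod n c x
    | add ξ η h h' => rw [map_add]; exact hadd _ _ h h'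
  refine DirectSum.induction_on (motive := P) ξ ?_ hincl hadd
  have := hincl 0 0
  rwa [map_zero] at this

theorem inner_incl_incl (q : unitInterval) (n : ℕ) (ξ η : ⨂[𝕜]^n H) :
    inner 𝕜 (incl 𝕜 H q n ξ) (incl 𝕜 H q n η) = form (q : ℝ) ξ η := by
  rw [inner_preFock]
  refine (preForm_lof_right (q : ℝ) _ n η).trans ?_
  exact congrArg (fun ζ => form (q : ℝ) ζ η) (DirectSum.lof_apply (M := fun n => ⨂[𝕜]^n H) 𝕜 n ξ)

theorem inner_incl_of_ne (q : unitInterval) {m n : ℕ} (h : m ≠ n) (ξ : ⨂[𝕜]^m H)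
    (η : ⨂[𝕜]^n H) : inner 𝕜 (incl 𝕜 H q m ξ) (incl 𝕜 H q n η) = 0 := by
  rw [inner_preFock]
  refine (preForm_lof_right (q : ℝ) _ n η).trans ?_
  refine (congrArg (fun ζ => form (q : ℝ) ζ η)
    (DirectSum.of_eq_of_ne (β := fun n => ⨂[𝕜]^n H) m n ξ h.symm)).trans ?_
  simp

/-! ### Creation, annihilation and number operators on the algebraic Fock space -/

/-- Creation: `x₁ ⊗ ⋯ ⊗ xₙ ↦ f ⊗ x₁ ⊗ ⋯ ⊗ xₙ`. -/
def preCreation (q : unitInterval) (f : H) : PreFock 𝕜 H q →ₗ[𝕜] PreFock 𝕜 H q :=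
  fromLevels 𝕜 H q fun n => incl 𝕜 H q (n + 1) ∘ₗ
    lift ((tprod 𝕜 : MultilinearMap 𝕜 (fun _ : Fin (n + 1) => H) _).curryLeft f)

/-- Annihilation from level `n + 1` to level `n`:
`x₀ ⊗ ⋯ ⊗ xₙ ↦ qⁿ ∑ₖ qᵏ ⟨f, xₖ⟩ x₀ ⊗ ⋯ x̌ₖ ⋯ ⊗ xₙ`, the sum over `0 ≤ k ≤ n`. -/
def annihilationLevel (q : ℝ) (f : H) (n : ℕ) : (⨂[𝕜]^(n + 1) H) →ₗ[𝕜] ⨂[𝕜]^n H :=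
  lift ((q : 𝕜) ^ n • ∑ k : Fin (n + 1), (q : 𝕜) ^ (k : ℕ) •
    LinearMap.uncurryMid k ((innerₛₗ 𝕜 f).smulRight (PiTensorProduct.tprod 𝕜)))

/-- Annihilation; it kills the vacuum and is `annihilationLevel` on the higher levels. -/
def preAnnihilation (q : unitInterval) (f : H) : PreFock 𝕜 H q →ₗ[𝕜] PreFock 𝕜 H q :=
  fromLevels 𝕜 H q fun n => match n with
    | 0 => 0
    | n + 1 => incl 𝕜 H q n ∘ₗ annihilationLevel (q : ℝ) f n

variable (𝕜 H) in
/-- The operator `q ^ N`, with `N` the number operator: multiplication by `qⁿ` on `H^{⊗ n}`. -/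
def preQPowN (q : unitInterval) : PreFock 𝕜 H q →ₗ[𝕜] PreFock 𝕜 H q :=
  fromLevels 𝕜 H q fun n => (((q : ℝ) : 𝕜) ^ n) • incl 𝕜 H q n

variable (𝕜 H) in
/-- The vacuum vector, the empty tensor in `H^{⊗ 0}`. -/
def preVacuum (q : unitInterval) : PreFock 𝕜 H q := incl 𝕜 H q 0 (tprod 𝕜 Fin.elim0)

theorem preCreation_tprod (q : unitInterval) (f : H) {n : ℕ} (x : Fin n → H) :
    preCreation q f (incl 𝕜 H q n (tprod 𝕜 x)) =
      incl 𝕜 H q (n + 1) (tprod 𝕜 (Fin.cons f x : Fin (n + 1) → H)) := by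
  simp [preCreation, fromLevels_incl]

theorem preAnnihilation_zero (q : unitInterval) (f : H) (ξ : ⨂[𝕜]^0 H) :
    preAnnihilation q f (incl 𝕜 H q 0 ξ) = 0 := by
  simp [preAnnihilation, fromLevels_incl]

theorem preAnnihilation_tprod (q : unitInterval) (f : H) {n : ℕ} (x : Fin (n + 1) → H) :
    preAnnihilation q f (incl 𝕜 H q (n + 1) (tprod 𝕜 x)) =
      ((q : ℝ) : 𝕜) ^ n • ∑ k : Fin (n + 1), (((q : ℝ) : 𝕜) ^ (k : ℕ) * inner 𝕜 f (x k)) •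
        incl 𝕜 H q n (tprod 𝕜 (k.removeNth x)) := by
  simp [preAnnihilation, annihilationLevel, fromLevels_incl, mul_smul]

theorem preQPowN_incl (q : unitInterval) {n : ℕ} (ξ : ⨂[𝕜]^n H) :
    preQPowN 𝕜 H q (incl 𝕜 H q n ξ) = ((q : ℝ) : 𝕜) ^ n • incl 𝕜 H q n ξ := by
  simp [preQPowN, fromLevels_incl]

/-- Annihilation is the adjoint of creation for the `q`-discrete inner product. -/
theorem inner_preCreation_left (q : unitInterval) (f : H) (ξ η : PreFock 𝕜 H q) :
    inner 𝕜 (preCreation q f ξ) η = inner 𝕜 ξ (preAnnihilation q f η) := by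
  induction ξ using preFock_induction with
  | hadd ξ ξ' h h' => simp only [map_add, inner_add_left, h, h']
  | htprod m c x =>
    induction η using preFock_induction with
    | hadd η η' h h' => simp only [map_add, inner_add_right, h, h']
    | htprod n d y =>
      simp only [map_smul, inner_smul_left, inner_smul_right]
      congr 2
      rw [preCreation_tprod]
      cases n with
      | zero =>
        rw [preAnnihilation_zero, inner_zero_right, inner_incl_of_ne q (Nat.succ_ne_zero m)]
      | succ n =>
        rw [preAnnihilation_tprod, inner_smul_right, inner_sum]
        simp only [inner_smul_right]
        rcases eq_or_ne m n with rfl | hmn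
        · simp only [inner_incl_incl, form_tprod]
          exact kernel_cons (q : ℝ) f x y
        · rw [inner_incl_of_ne q (by omega)]
          simp [inner_incl_of_ne q hmn]

theorem inner_preQPowN_left (q : unitInterval) (ξ η : PreFock 𝕜 H q) :
    inner 𝕜 (preQPowN 𝕜 H q ξ) η = inner 𝕜 ξ (preQPowN 𝕜 H q η) := by
  induction ξ using preFock_induction with
  | hadd ξ ξ' h h' => simp only [map_add, inner_add_left, h, h']
  | htprod m c x =>
    induction η using preFock_induction with
    | hadd η η' h h' => simp only [map_add, inner_add_right, h, h']
    | htprod n d y =>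
      simp only [map_smul, preQPowN_incl, inner_smul_left, inner_smul_right, map_pow,
        RCLike.conj_ofReal]
      rcases eq_or_ne m n with rfl | hmn
      · ring
      · simp [inner_incl_of_ne q hmn]

/-! ### The `q`-discrete Fock space -/

variable (𝕜 H) in
/-- The `q`-discrete Fock space: the Hilbert space completion of the algebraic Fock space. (The
completion also divides out the vectors of length zero, which exist for `q = 0` and `q = 1`.) -/
abbrev Fock (q : unitInterval) : Type _ := UniformSpace.Completion (PreFock 𝕜 H q)

variable (𝕜 H) in
/-- The canonical map from the algebraic Fock space to the Fock space. -/
def toFock (q : unitInterval) : PreFock 𝕜 H q →ₗ[𝕜] Fock 𝕜 H q :=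
  (UniformSpace.Completion.toComplₗᵢ (𝕜 := 𝕜) (E := PreFock 𝕜 H q)).toLinearMap

variable (𝕜 H) in
/-- The dense subspace of vectors with finitely many particles, the common invariant domain of
the operators. -/
def finiteParticle (q : unitInterval) : Submodule 𝕜 (Fock 𝕜 H q) :=
  LinearMap.range (toFock 𝕜 H q)

theorem dense_finiteParticle (q : unitInterval) :
    Dense (finiteParticle 𝕜 H q : Set (Fock 𝕜 H q)) := by
  have : (finiteParticle 𝕜 H q : Set (Fock 𝕜 H q)) =
      Set.range ((↑) : PreFock 𝕜 H q → Fock 𝕜 H q) := rfl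
  rw [this]
  exact UniformSpace.Completion.denseRange_coe

theorem norm_toFock (q : unitInterval) (ξ : PreFock 𝕜 H q) : ‖toFock 𝕜 H q ξ‖ = ‖ξ‖ :=
  (UniformSpace.Completion.toComplₗᵢ (𝕜 := 𝕜) (E := PreFock 𝕜 H q)).norm_map ξ

theorem inner_toFock (q : unitInterval) (ξ η : PreFock 𝕜 H q) :
    inner 𝕜 (toFock 𝕜 H q ξ) (toFock 𝕜 H q η) = inner 𝕜 ξ η :=
  UniformSpace.Completion.inner_coe ξ η

/-- An operator with an adjoint maps vectors of length zero to such vectors. -/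
theorem ker_le_of_adjoint {q : unitInterval} {T S : PreFock 𝕜 H q →ₗ[𝕜] PreFock 𝕜 H q}
    (h : ∀ ξ η, inner 𝕜 (T ξ) η = inner 𝕜 ξ (S η)) :
    LinearMap.ker (toFock 𝕜 H q) ≤ (LinearMap.ker (toFock 𝕜 H q)).comap T := by
  intro ξ hξ
  rw [LinearMap.mem_ker] at hξ
  rw [Submodule.mem_comap, LinearMap.mem_ker]
  have : inner 𝕜 (toFock 𝕜 H q (T ξ)) (toFock 𝕜 H q (T ξ)) = 0 := by
    rw [inner_toFock, h, ← inner_toFock, hξ, inner_zero_left]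
  exact inner_self_eq_zero.1 this

/-- The operator on finite particle vectors induced by an operator on the algebraic Fock space
that preserves the vectors of length zero; it is characterized by `descend_apply`. -/
def descend {q : unitInterval} (T : PreFock 𝕜 H q →ₗ[𝕜] PreFock 𝕜 H q)
    (hT : LinearMap.ker (toFock 𝕜 H q) ≤ (LinearMap.ker (toFock 𝕜 H q)).comap T) :
    Module.End 𝕜 (finiteParticle 𝕜 H q) :=
  (toFock 𝕜 H q).quotKerEquivRange.toLinearMap ∘ₗ
    (LinearMap.ker (toFock 𝕜 H q)).mapQ (LinearMap.ker (toFock 𝕜 H q)) T hT ∘ₗ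
      (toFock 𝕜 H q).quotKerEquivRange.symm.toLinearMap

variable (𝕜 H) in
/-- The canonical map from the algebraic Fock space onto the finite particle vectors. -/
def toFinite (q : unitInterval) : PreFock 𝕜 H q →ₗ[𝕜] finiteParticle 𝕜 H q :=
  (toFock 𝕜 H q).rangeRestrict

theorem descend_apply {q : unitInterval} (T : PreFock 𝕜 H q →ₗ[𝕜] PreFock 𝕜 H q)
    (hT : LinearMap.ker (toFock 𝕜 H q) ≤ (LinearMap.ker (toFock 𝕜 H q)).comap T)
    (ξ : PreFock 𝕜 H q) : descend T hT (toFinite 𝕜 H q ξ) = toFinite 𝕜 H q (T ξ) := by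
  have h : (toFock 𝕜 H q).quotKerEquivRange.symm (toFinite 𝕜 H q ξ) =
      Submodule.Quotient.mk ξ :=
    (LinearEquiv.symm_apply_eq _).2 rfl
  change (toFock 𝕜 H q).quotKerEquivRange ((LinearMap.ker (toFock 𝕜 H q)).mapQ
    (LinearMap.ker (toFock 𝕜 H q)) T hT
      ((toFock 𝕜 H q).quotKerEquivRange.symm (toFinite 𝕜 H q ξ))) = _
  exact congrArg (fun ζ => (toFock 𝕜 H q).quotKerEquivRange ((LinearMap.ker (toFock 𝕜 H q)).mapQ
    (LinearMap.ker (toFock 𝕜 H q)) T hT ζ)) h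

/-- The creation operator `C⁺(f)`. -/
def creation (q : unitInterval) (f : H) : Module.End 𝕜 (finiteParticle 𝕜 H q) :=
  descend (preCreation q f) (ker_le_of_adjoint (inner_preCreation_left q f))

/-- The annihilation operator `C(f)`. -/
def annihilation (q : unitInterval) (f : H) : Module.End 𝕜 (finiteParticle 𝕜 H q) :=
  descend (preAnnihilation q f) (ker_le_of_adjoint (S := preCreation q f) fun ξ η => by
    rw [← inner_conj_symm, ← inner_preCreation_left, inner_conj_symm])

variable (𝕜 H) in
/-- The operator `q ^ N`, with `N` the number operator. -/
def qPowN (q : unitInterval) : Module.End 𝕜 (finiteParticle 𝕜 H q) :=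
  descend (preQPowN 𝕜 H q) (ker_le_of_adjoint (inner_preQPowN_left q))

/-- On the finite particle vectors, `C(f)` is the adjoint of `C⁺(f)`. -/
theorem inner_creation_left (q : unitInterval) (f : H) (ξ η : finiteParticle 𝕜 H q) :
    inner 𝕜 (creation q f ξ) η = inner 𝕜 ξ (annihilation q f η) := by
  obtain ⟨ξ, rfl⟩ : ∃ ξ', toFinite 𝕜 H q ξ' = ξ := LinearMap.surjective_rangeRestrict _ ξ
  obtain ⟨η, rfl⟩ : ∃ η', toFinite 𝕜 H q η' = η := LinearMap.surjective_rangeRestrict _ η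
  rw [creation, annihilation, descend_apply, descend_apply, Submodule.coe_inner,
    Submodule.coe_inner]
  exact (inner_toFock q _ _).trans ((inner_preCreation_left q f ξ η).trans
    (inner_toFock q _ _).symm)

/-- The `q`-discrete Gaussian operator `G(f) = C(f) + C⁺(f)`. -/
def gaussian (q : unitInterval) (f : H) : Module.End 𝕜 (finiteParticle 𝕜 H q) :=
  annihilation q f + creation q f

variable (𝕜 H) in
/-- The vacuum vector `Ω`. -/
def vacuum (q : unitInterval) : finiteParticle 𝕜 H q := toFinite 𝕜 H q (preVacuum 𝕜 H q)

/-- The vacuum expectation `⟨T Ω | Ω⟩` in the Fock space; Mathlib's inner product is linear in the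
second argument, so it reads `⟪Ω, T Ω⟫`. -/
def vacuumExpectation {q : unitInterval} (T : Module.End 𝕜 (finiteParticle 𝕜 H q)) : 𝕜 :=
  inner 𝕜 (vacuum 𝕜 H q : Fock 𝕜 H q) (T (vacuum 𝕜 H q) : Fock 𝕜 H q)

end Fock

/-! ### Pair partitions -/

/-- A pair partition of `{0, …, m - 1}`, written as the set of its blocks `(i, j)` with `i < j`:
every point lies in exactly one block. -/
def IsPairPartition {m : ℕ} (V : Finset (Fin m × Fin m)) : Prop :=
  (∀ p ∈ V, p.1 < p.2) ∧ ∀ k : Fin m, ∃! p, p ∈ V ∧ (k = p.1 ∨ k = p.2)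

open Classical in
/-- The set `P₂(m)` of pair partitions of `m` points. -/
def pairPartitions (m : ℕ) : Finset (Finset (Fin m × Fin m)) :=
  Finset.univ.filter IsPairPartition

/-- The number of crossings: pairs of blocks `(a, b)`, `(c, d)` with `a < c < b < d`. -/
def cr {m : ℕ} (V : Finset (Fin m × Fin m)) : ℕ :=
  ((V ×ˢ V).filter fun p => p.1.1 < p.2.1 ∧ p.2.1 < p.1.2 ∧ p.1.2 < p.2.2).card

/-- The number of nestings: pairs of blocks `(a, b)`, `(c, d)` with `a < c < d < b`. -/
def pbr {m : ℕ} (V : Finset (Fin m × Fin m)) : ℕ :=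
  ((V ×ˢ V).filter fun p => p.1.1 < p.2.1 ∧ p.2.1 < p.2.2 ∧ p.2.2 < p.1.2).card

/-- The number of inner points: the sum over the blocks `(i, j)` of the number of `k` with
`i < k < j`. -/
def ip {m : ℕ} (V : Finset (Fin m × Fin m)) : ℕ :=
  ∑ p ∈ V, (Finset.univ.filter fun k : Fin m => p.1 < k ∧ k < p.2).card

/-- The statistic `e₀ = pbr + 2 cr`. -/
def e0 {m : ℕ} (V : Finset (Fin m × Fin m)) : ℕ := pbr V + 2 * cr V

/-! ### Type I discrete `q`-Hermite polynomials and their measure -/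

/-- The `q`-integer `[n]_q = 1 + q + ⋯ + q ^ (n - 1)`. -/
def qInt (q : ℝ) (n : ℕ) : ℝ := ∑ i ∈ Finset.range n, q ^ i

/-- Type I discrete `q`-Hermite polynomials: `h₀ = 1`, `h₁ = x` and
`x hₙ = hₙ₊₁ + q ^ (n - 1) [n]_q hₙ₋₁` for `n ≥ 1`. -/
def hermiteI (q : ℝ) : ℕ → Polynomial ℝ
  | 0 => 1
  | 1 => Polynomial.X
  | n + 2 => Polynomial.X * hermiteI q (n + 1) -
      Polynomial.C (q ^ n * qInt q (n + 1)) * hermiteI q n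

/-- `μ` is a type I discrete `q`-Hermite measure: a probability measure on the real line with
finite moments of all orders for which the polynomials `hₙ` are pairwise orthogonal. -/
structure IsHermiteIMeasure (q : ℝ) (μ : MeasureTheory.Measure ℝ) : Prop where
  isProbabilityMeasure : MeasureTheory.IsProbabilityMeasure μ
  integrable_pow : ∀ k : ℕ, MeasureTheory.Integrable (fun x : ℝ => x ^ k) μ
  orthogonal : ∀ m n : ℕ, m ≠ n →
    ∫ x, (hermiteI q m).eval x * (hermiteI q n).eval x ∂μ = 0

end QDiscrete

end

/-! Words `x₁ ⊗ ⋯ ⊗ xₙ` span the finite particle vectors, so everything is computed on them.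
Deleting the `k`-th letter of a word (counted from `0`) costs `q ^ (n - 1 + k)`. Prefixing a letter
raises both `n` and `k` by one, which gives the `q ^ 2` in the commutation relation; deleting the
new letter itself gives the `q ^ N` term.

Wick formula: apply the operators to `Ω` from right to left and record the indices of the letters
not yet contracted. Creation leaves a new right end point open; annihilation closes a block at the
`k`-th of `ℓ` open points. The new block crosses the `k` blocks ending earlier and is nested in the
`ℓ - 1 - k` blocks ending later, so `e₀ = pbr + 2 cr` grows by `ℓ - 1 + k`, the exponent in the
annihilation operator (`e0_insert`, `sum_openPartitions_succ`). Counting inner points by the blocks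
that own them gives `ip = 2 pbr + 2 cr` (`IsPairPartition.ip_eq`), hence the exponent `ip / 2 + cr`.

Moments: for a unit vector, `hₙ(G) Ω = f^{⊗ n}`, so the vacuum functional kills every `hₙ` with `n ≥
1`. So does integration against a Hermite measure, by orthogonality to `h₀`; as the `hₙ` span all
polynomials, the two agree. The Appell identity `D hₙ₊₁ = [n + 1]_q hₙ` for the `q`-derivative `D`
turns this vanishing into `Λ(x p) = Λ(D p)`, which yields the moments `[1]_q [3]_q ⋯ [2n - 1]_q`.
The sum over pair partitions is the Wick formula for the same vacuum moment.

Existence: by the converse argument it suffices to exhibit a probability measure with these moments,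
namely the standard normal law for `q = 1` and a symmetric measure on the points `± qᵏ / √(1 - q)`
for `q < 1`. -/

noncomputable section

namespace QDiscrete

open scoped TensorProduct DirectSum ComplexOrder
open PiTensorProduct

/-! ### Action of the operators on words -/

section Words

variable {𝕜 H : Type*} [RCLike 𝕜] [NormedAddCommGroup H] [InnerProductSpace 𝕜 H]

variable (𝕜) in
/-- The finite particle vector `x₁ ⊗ ⋯ ⊗ xₙ` of a word `[x₁, …, xₙ]`. -/
def wordVec (q : unitInterval) (L : List H) : finiteParticle 𝕜 H q :=
  toFinite 𝕜 H q (incl 𝕜 H q L.length (tprod 𝕜 L.get))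

theorem toFinite_surjective (q : unitInterval) : Function.Surjective (toFinite 𝕜 H q) :=
  LinearMap.surjective_rangeRestrict _

theorem incl_tprod_congr (q : unitInterval) {m n : ℕ} (h : m = n) (x : Fin m → H) (y : Fin n → H)
    (hxy : ∀ i, x i = y (Fin.cast h i)) :
    incl 𝕜 H q m (tprod 𝕜 x) = incl 𝕜 H q n (tprod 𝕜 y) := by
  subst h
  rw [funext hxy]
  rfl

theorem incl_tprod_eq_wordVec (q : unitInterval) {n : ℕ} (x : Fin n → H) :
    toFinite 𝕜 H q (incl 𝕜 H q n (tprod 𝕜 x)) = wordVec 𝕜 q (List.ofFn x) := by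
  unfold wordVec
  rw [incl_tprod_congr q (List.length_ofFn (f := x)).symm x]
  intro i
  simp

theorem vacuum_eq_wordVec (q : unitInterval) : vacuum 𝕜 H q = wordVec 𝕜 q [] := by
  unfold vacuum preVacuum wordVec
  congr 3
  exact Subsingleton.elim _ _

/-- Words span because simple tensors span each level and the algebraic Fock space maps onto the
finite particle vectors. Lists, rather than tuples, keep words of different lengths in one type. -/
theorem finiteParticle_end_ext {q : unitInterval} {S T : Module.End 𝕜 (finiteParticle 𝕜 H q)}
    (h : ∀ L : List H, S (wordVec 𝕜 q L) = T (wordVec 𝕜 q L)) : S = T := by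
  ext1 ξ
  obtain ⟨ξ, rfl⟩ := toFinite_surjective q ξ
  induction ξ using preFock_induction with
  | htprod n c x => simp only [map_smul, incl_tprod_eq_wordVec, h]
  | hadd ξ η h₁ h₂ => simp only [map_add, h₁, h₂]

theorem creation_wordVec (q : unitInterval) (f : H) (L : List H) :
    creation q f (wordVec 𝕜 q L) = wordVec 𝕜 q (f :: L) := by
  unfold creation wordVec
  rw [descend_apply, preCreation_tprod]
  congr 3
  funext i
  refine Fin.cases ?_ (fun i => ?_) i <;> simp

theorem qPowN_wordVec (q : unitInterval) (L : List H) :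
    qPowN 𝕜 H q (wordVec 𝕜 q L) = ((q : ℝ) : 𝕜) ^ L.length • wordVec 𝕜 q L := by
  unfold qPowN wordVec
  rw [descend_apply, preQPowN_incl, map_smul]

/-- The truncated `L.length - 1` is harmless: it differs from the true value only for the empty
word, where the sum is empty. -/
theorem annihilation_wordVec (q : unitInterval) (f : H) (L : List H) :
    annihilation q f (wordVec 𝕜 q L) =
      ∑ k : Fin L.length, (((q : ℝ) : 𝕜) ^ (L.length - 1 + k) * inner 𝕜 f (L.get k)) •
        wordVec 𝕜 q (L.eraseIdx k) := by
  cases L with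
  | nil =>
    unfold annihilation wordVec
    rw [descend_apply]
    exact (congrArg _ (preAnnihilation_zero q f _)).trans (by simp)
  | cons a L =>
    have h : annihilation q f (wordVec 𝕜 q (a :: L)) =
      toFinite 𝕜 H q (preAnnihilation q f (incl 𝕜 H q (L.length + 1) (tprod 𝕜 (a :: L).get))) :=
      descend_apply _ _ _
    rw [h, preAnnihilation_tprod, map_smul, map_sum, Finset.smul_sum]
    refine Finset.sum_congr rfl fun k _ => ?_
    rw [map_smul, smul_smul, ← mul_assoc, ← pow_add]
    congr 1
    have hk : (k : ℕ) < (a :: L).length := k.2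
    rw [wordVec]
    congr 1
    refine incl_tprod_congr q (by rw [List.length_eraseIdx_of_lt hk]; simp) _ _ fun i => ?_
    simp only [Fin.removeNth, List.get_eq_getElem, Fin.val_cast, List.getElem_eraseIdx,
      Fin.succAbove, Fin.lt_def, Fin.val_castSucc]
    split_ifs <;> rfl

theorem annihilation_creation_commutation (q : unitInterval) (f g : H) :
    annihilation q f * creation q g - (((q : ℝ) : 𝕜) ^ 2) • (creation q g * annihilation q f) =
      inner 𝕜 f g • qPowN 𝕜 H q := by
  refine finiteParticle_end_ext fun L => ?_
  simp only [LinearMap.sub_apply, Module.End.mul_apply, LinearMap.smul_apply, creation_wordVec,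
    annihilation_wordVec, qPowN_wordVec, map_sum, map_smul, Finset.smul_sum, smul_smul]
  rw [sub_eq_iff_eq_add]
  -- The term `k = 0` deletes the letter `g` just created and gives `q ^ N`; the others delete
  -- letters of `L`.
  refine (Fin.sum_univ_succ (n := L.length) _).trans ?_
  congr 1
  · simp [mul_comm]
  · refine Finset.sum_congr rfl fun k _ => ?_
    have hk : 0 < L.length := k.pos
    congr 1
    -- One power of `q` comes from the greater length, the other from the shifted position.
    have : (g :: L).length - 1 + ((k.succ : Fin (L.length + 1)) : ℕ) =
        2 + (L.length - 1 + k) := by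
      simp only [List.length_cons, Fin.val_succ]; omega
    rw [this, pow_add, mul_assoc]
    rfl

theorem inner_vacuum_wordVec (q : unitInterval) (L : List H) :
    inner 𝕜 (vacuum 𝕜 H q : Fock 𝕜 H q) (wordVec 𝕜 q L : Fock 𝕜 H q) =
      if L = [] then 1 else 0 := by
  have h : inner 𝕜 (vacuum 𝕜 H q : Fock 𝕜 H q) (wordVec 𝕜 q L : Fock 𝕜 H q) =
      inner 𝕜 (preVacuum 𝕜 H q) (incl 𝕜 H q L.length (tprod 𝕜 L.get)) := inner_toFock q _ _
  rw [h, preVacuum]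
  split_ifs with hL
  · subst hL
    refine (inner_incl_incl q 0 _ _).trans ?_
    rw [form_tprod, kernel]
    simp [inv]
  · exact inner_incl_of_ne q (by simpa [eq_comm] using hL) _ _

theorem inner_wordVec_of_length_ne (q : unitInterval) {L L' : List H} (h : L.length ≠ L'.length) :
    inner 𝕜 (wordVec 𝕜 q L : Fock 𝕜 H q) (wordVec 𝕜 q L' : Fock 𝕜 H q) = 0 :=
  (inner_toFock q _ _).trans (inner_incl_of_ne q h _ _)

theorem inner_gaussian_left (q : unitInterval) (f : H) (ξ η : finiteParticle 𝕜 H q) :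
    inner 𝕜 (gaussian q f ξ) η = inner 𝕜 ξ (gaussian q f η) := by
  have h : inner 𝕜 (annihilation q f ξ) η = inner 𝕜 ξ (creation q f η) := by
    rw [← inner_conj_symm, ← inner_creation_left, inner_conj_symm]
  simp only [gaussian, LinearMap.add_apply, inner_add_left, inner_add_right, h,
    inner_creation_left]
  exact add_comm _ _

/-- All deletions from `f^{⊗ (n + 1)}` leave the same word, so the weights add up to a `q`-integer.
This is the three-term recursion of the Hermite polynomials. -/
theorem gaussian_wordVec_replicate (q : unitInterval) {f : H} (hf : ‖f‖ = 1) (n : ℕ) :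
    gaussian q f (wordVec 𝕜 q (List.replicate (n + 1) f)) =
      wordVec 𝕜 q (List.replicate (n + 2) f) +
        ((q ^ n * qInt q (n + 1) : ℝ) : 𝕜) • wordVec 𝕜 q (List.replicate n f) := by
  rw [gaussian, LinearMap.add_apply, creation_wordVec, annihilation_wordVec, add_comm]
  congr 1
  have : ∀ k : Fin (List.replicate (n + 1) f).length,
      (((q : ℝ) : 𝕜) ^ ((List.replicate (n + 1) f).length - 1 + k) *
        inner 𝕜 f ((List.replicate (n + 1) f).get k)) •
        wordVec 𝕜 q ((List.replicate (n + 1) f).eraseIdx k) =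
      (((q : ℝ) : 𝕜) ^ n * ((q : ℝ) : 𝕜) ^ (k : ℕ)) • wordVec 𝕜 q (List.replicate n f) := by
    intro k
    have hk : (k : ℕ) < n + 1 := by simpa using k.2
    rw [List.eraseIdx_replicate, if_pos hk]
    simp [hf, pow_add]
  rw [Finset.sum_congr rfl fun k _ => this k, ← Finset.sum_smul]
  congr 1
  rw [← Finset.mul_sum, Fin.sum_univ_eq_sum_range (fun k => ((q : ℝ) : 𝕜) ^ k)]
  simp [qInt]

theorem gaussian_vacuum (q : unitInterval) (f : H) :
    gaussian q f (vacuum 𝕜 H q) = wordVec 𝕜 q [f] := by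
  rw [vacuum_eq_wordVec, gaussian, LinearMap.add_apply, creation_wordVec, annihilation_wordVec]
  simp

theorem aeval_hermiteI_gaussian_vacuum (q : unitInterval) {f : H} (hf : ‖f‖ = 1) (n : ℕ) :
    Polynomial.aeval (gaussian (𝕜 := 𝕜) q f)
        ((hermiteI q n).map (algebraMap ℝ 𝕜)) (vacuum 𝕜 H q) =
      wordVec 𝕜 q (List.replicate n f) := by
  induction n using Nat.twoStepInduction with
  | zero => simp [hermiteI, vacuum_eq_wordVec]
  | one => simp [hermiteI, gaussian_vacuum]
  | more n h₁ h₂ =>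
    rw [hermiteI, Polynomial.map_sub, Polynomial.map_mul, Polynomial.map_mul, map_sub, map_mul,
      map_mul, LinearMap.sub_apply, Module.End.mul_apply, Module.End.mul_apply, h₁, h₂,
      Polynomial.map_X, Polynomial.aeval_X, Polynomial.map_C, Polynomial.aeval_C,
      gaussian_wordVec_replicate q hf, Module.algebraMap_end_apply, add_sub_assoc]
    simp

end Words

/-! ### Combinatorics of pair partitions -/

section PairPartitions

variable {M : ℕ}

/-- A pair partition of a set `A` of points. -/
def IsPairPartitionOn (A : Set (Fin M)) (V : Finset (Fin M × Fin M)) : Prop :=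
  (∀ p ∈ V, p.1 < p.2 ∧ p.1 ∈ A ∧ p.2 ∈ A) ∧ ∀ k ∈ A, ∃! p, p ∈ V ∧ (k = p.1 ∨ k = p.2)

theorem isPairPartitionOn_univ {V : Finset (Fin M × Fin M)} :
    IsPairPartitionOn Set.univ V ↔ IsPairPartition V := by
  simp [IsPairPartitionOn, IsPairPartition]

theorem IsPairPartitionOn.eq_of_mem {A : Set (Fin M)} {V : Finset (Fin M × Fin M)}
    (h : IsPairPartitionOn A V) {p r : Fin M × Fin M} (hp : p ∈ V) (hr : r ∈ V) {k : Fin M}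
    (hkp : k = p.1 ∨ k = p.2) (hkr : k = r.1 ∨ k = r.2) : p = r := by
  have hk : k ∈ A := by
    rcases hkp with rfl | rfl
    exacts [(h.1 p hp).2.1, (h.1 p hp).2.2]
  exact (h.2 k hk).unique ⟨hp, hkp⟩ ⟨hr, hkr⟩

theorem IsPairPartitionOn.insert {A : Set (Fin M)} {V : Finset (Fin M × Fin M)}
    (h : IsPairPartitionOn A V) {a b : Fin M} (hab : a < b) (ha : a ∉ A) (hb : b ∉ A) :
    IsPairPartitionOn (A ∪ {a, b}) (insert (a, b) V) := by
  constructor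
  · intro p hp
    rcases Finset.mem_insert.1 hp with rfl | hp
    · simp [hab]
    · exact ⟨(h.1 p hp).1, Or.inl (h.1 p hp).2.1, Or.inl (h.1 p hp).2.2⟩
  · intro k hk
    by_cases hkA : k ∈ A
    · obtain ⟨p, ⟨hp, hkp⟩, hu⟩ := h.2 k hkA
      refine ⟨p, ⟨Finset.mem_insert_of_mem hp, hkp⟩, fun r hr => ?_⟩
      rcases Finset.mem_insert.1 hr.1 with rfl | hr'
      · rcases hr.2 with rfl | rfl
        exacts [absurd hkA ha, absurd hkA hb]
      · exact hu r ⟨hr', hr.2⟩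
    · have hkab : k = a ∨ k = b := by simpa [hkA] using hk
      refine ⟨(a, b), ⟨Finset.mem_insert_self _ _, hkab⟩, fun r hr => ?_⟩
      rcases Finset.mem_insert.1 hr.1 with rfl | hr'
      · rfl
      · rcases hr.2 with rfl | rfl
        exacts [absurd (h.1 r hr').2.1 hkA, absurd (h.1 r hr').2.2 hkA]

theorem IsPairPartitionOn.erase {A : Set (Fin M)} {V : Finset (Fin M × Fin M)}
    (h : IsPairPartitionOn A V) {a b : Fin M} (hab : (a, b) ∈ V) :
    IsPairPartitionOn (A \ {a, b}) (V.erase (a, b)) := by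
  constructor
  · intro p hp
    have hp' := Finset.mem_of_mem_erase hp
    have hne := Finset.ne_of_mem_erase hp
    refine ⟨(h.1 p hp').1, ⟨(h.1 p hp').2.1, ?_⟩, ⟨(h.1 p hp').2.2, ?_⟩⟩ <;> intro hk
    · exact hne (h.eq_of_mem hp' hab (Or.inl rfl) hk)
    · exact hne (h.eq_of_mem hp' hab (Or.inr rfl) hk)
  · rintro k ⟨hk, hkab⟩
    obtain ⟨p, ⟨hp, hkp⟩, hu⟩ := h.2 k hk
    refine ⟨p, ⟨Finset.mem_erase.2 ⟨?_, hp⟩, hkp⟩, fun r hr =>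
      hu r ⟨Finset.mem_of_mem_erase hr.1, hr.2⟩⟩
    rintro rfl
    exact hkab hkp

/-! #### The statistics as double sums -/

theorem cr_eq_sum (V : Finset (Fin M × Fin M)) :
    cr V = ∑ p ∈ V, ∑ d ∈ V, if p.1 < d.1 ∧ d.1 < p.2 ∧ p.2 < d.2 then 1 else 0 := by
  rw [cr, Finset.card_filter, Finset.sum_product]

theorem pbr_eq_sum (V : Finset (Fin M × Fin M)) :
    pbr V = ∑ p ∈ V, ∑ d ∈ V, if p.1 < d.1 ∧ d.1 < d.2 ∧ d.2 < p.2 then 1 else 0 := by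
  rw [pbr, Finset.card_filter, Finset.sum_product]

/-- Every point is counted once by the blocks of a pair partition. -/
theorem IsPairPartition.sum_indicator {V : Finset (Fin M × Fin M)} (h : IsPairPartition V)
    (P : Fin M → Prop) [DecidablePred P] :
    (Finset.univ.filter P).card =
      ∑ d ∈ V, ((if P d.1 then 1 else 0) + (if P d.2 then 1 else 0)) := by
  rw [Finset.card_filter]
  have hk : ∀ k : Fin M, (if P k then 1 else 0) =
      ∑ d ∈ V, ((if d.1 = k then (if P k then 1 else 0) else 0) +
        (if d.2 = k then (if P k then 1 else 0) else 0)) := by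
    intro k
    obtain ⟨p, ⟨hp, hkp⟩, hu⟩ := h.2 k
    rw [Finset.sum_eq_single_of_mem p hp]
    · have hlt := h.1 p hp
      rcases hkp with rfl | rfl
      · simp [hlt.ne']
      · simp [hlt.ne]
    · intro d hd hne
      have h1 : d.1 ≠ k := fun e => hne (hu d ⟨hd, Or.inl e.symm⟩)
      have h2 : d.2 ≠ k := fun e => hne (hu d ⟨hd, Or.inr e.symm⟩)
      simp [h1, h2]
  rw [Finset.sum_congr rfl fun k _ => hk k, Finset.sum_comm]
  refine Finset.sum_congr rfl fun d _ => ?_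
  simp [Finset.sum_add_distrib]

/-- Each inner point of a block is an end point of another block. A nested pair puts both end points
of the inner block inside the outer one; a crossing pair puts one end point of each block inside the
other. Either kind of pair thus contributes two. -/
theorem IsPairPartition.ip_eq {V : Finset (Fin M × Fin M)} (h : IsPairPartition V) :
    ip V = 2 * pbr V + 2 * cr V := by
  have hip : ip V = ∑ p ∈ V, ∑ d ∈ V,
      ((if p.1 < d.1 ∧ d.1 < p.2 then 1 else 0) + (if p.1 < d.2 ∧ d.2 < p.2 then 1 else 0)) :=
    Finset.sum_congr rfl fun p _ => h.sum_indicator fun k => p.1 < k ∧ k < p.2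
  -- Crossings counted from the later block: each is seen once from either side.
  have hcr : cr V = ∑ p ∈ V, ∑ d ∈ V, if d.1 < p.1 ∧ p.1 < d.2 ∧ d.2 < p.2 then 1 else 0 := by
    rw [cr_eq_sum, Finset.sum_comm]
  have key : ip V = pbr V + pbr V + (cr V + cr V) := by
    refine Eq.trans ?_ (congrArg (pbr V + pbr V + ·)
      (congrArg₂ (· + ·) (cr_eq_sum V) hcr).symm)
    rw [hip, pbr_eq_sum]
    simp only [← Finset.sum_add_distrib]
    refine Finset.sum_congr rfl fun p hp => Finset.sum_congr rfl fun d hd => ?_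
    have hp' := h.1 p hp
    have hd' := h.1 d hd
    have hpd : p.1 ≠ d.1 ∧ p.2 ≠ d.2 ∨ p = d := by
      by_cases e : p = d
      · exact Or.inr e
      · refine Or.inl ⟨fun e' => e ?_, fun e' => e ?_⟩
        · exact (h.2 p.1).unique ⟨hp, Or.inl rfl⟩ ⟨hd, Or.inl e'⟩
        · exact (h.2 p.2).unique ⟨hp, Or.inr rfl⟩ ⟨hd, Or.inr e'⟩
    rcases hpd with ⟨h1, h2⟩ | rfl
    · simp only [Fin.lt_def, ne_eq, Fin.ext_iff] at *
      split_ifs <;> omega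
    · simp
  omega

theorem IsPairPartition.e0_eq {V : Finset (Fin M × Fin M)} (h : IsPairPartition V) :
    (e0 V : ℝ) = (ip V : ℝ) / 2 + (cr V : ℝ) := by
  rw [e0, h.ip_eq]
  push_cast
  ring

theorem mem_pairPartitions {V : Finset (Fin M × Fin M)} :
    V ∈ pairPartitions M ↔ IsPairPartition V := by
  simp [pairPartitions]

/-! #### Pair partitions in which the last points are not paired with each other -/

/-- The points before `m` together with those in `L`. -/
def pointSet (m : ℕ) (L : List (Fin M)) : Set (Fin M) := {i | (i : ℕ) < m ∨ i ∈ L}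

open Classical in
/-- The pair partitions of `pointSet m L` whose blocks all begin before `m`. -/
def openPartitions (m : ℕ) (L : List (Fin M)) : Finset (Finset (Fin M × Fin M)) :=
  Finset.univ.filter fun V => IsPairPartitionOn (pointSet m L) V ∧ ∀ p ∈ V, (p.1 : ℕ) < m

theorem mem_openPartitions {m : ℕ} {L : List (Fin M)} {V : Finset (Fin M × Fin M)} :
    V ∈ openPartitions m L ↔
      IsPairPartitionOn (pointSet m L) V ∧ ∀ p ∈ V, (p.1 : ℕ) < m := by
  simp [openPartitions]

theorem openPartitions_full : openPartitions M [] = pairPartitions M := by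
  ext V
  have : pointSet M ([] : List (Fin M)) = Set.univ := by
    ext i; simp [pointSet]
  rw [mem_openPartitions, mem_pairPartitions, this, isPairPartitionOn_univ]
  exact and_iff_left fun p _ => p.1.2

theorem openPartitions_zero (L : List (Fin M)) :
    openPartitions 0 L = if L = [] then {∅} else ∅ := by
  split_ifs with h
  · subst h
    ext V
    rw [mem_openPartitions, Finset.mem_singleton]
    constructor
    · rintro ⟨-, h⟩
      exact Finset.eq_empty_of_forall_notMem fun p hp => absurd (h p hp) (Nat.not_lt_zero _)
    · rintro rfl
      simp [IsPairPartitionOn, pointSet]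
  · obtain ⟨i, hi⟩ := List.exists_mem_of_ne_nil L h
    refine Finset.eq_empty_of_forall_notMem fun V hV => ?_
    obtain ⟨h1, h2⟩ := mem_openPartitions.1 hV
    obtain ⟨p, ⟨hp, -⟩, -⟩ := h1.2 i (Or.inr hi)
    exact absurd (h2 p hp) (Nat.not_lt_zero _)

theorem pointSet_succ (m : Fin M) (L : List (Fin M)) :
    pointSet (m + 1) L = pointSet m (m :: L) := by
  ext i
  simp only [pointSet, Set.mem_ofPred_eq, List.mem_cons, Fin.ext_iff]
  rw [Nat.lt_succ_iff_lt_or_eq, or_assoc]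

/-- The elements that remain when the `k`-th one of an increasing list is removed. -/
theorem mem_eraseIdx_iff_of_sortedLT {L : List (Fin M)} (hL : L.Pairwise (· < ·))
    (k : Fin L.length) (i : Fin M) : i ∈ L.eraseIdx k ↔ i ∈ L ∧ i ≠ L.get k := by
  have hnd : L.Nodup := hL.imp ne_of_lt
  rw [← List.Nodup.erase_get hnd k, hnd.mem_erase_iff]
  exact and_comm

/-- In an increasing list the entries below and above the `k`-th are those placed before and after
it. The two counts become the numbers of new crossings and new nestings. -/
theorem card_filter_eraseIdx {L : List (Fin M)} (hL : L.Pairwise (· < ·)) (k : Fin L.length) :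
    ((L.eraseIdx k).toFinset.filter fun i => i < L.get k).card = k ∧
    ((L.eraseIdx k).toFinset.filter fun i => L.get k < i).card = L.length - 1 - k := by
  have hk := k.2
  have hL' : (L.take k ++ L.get k :: L.drop (k + 1)).Pairwise (· < ·) := by
    rw [List.get_eq_getElem, List.getElem_cons_drop, List.take_append_drop]; exact hL
  rw [List.pairwise_append, List.pairwise_cons] at hL'
  obtain ⟨h1, ⟨h2, h3⟩, h4⟩ := hL'
  have hlt : ∀ i ∈ L.take k, i < L.get k := fun i hi => h4 i hi _ List.mem_cons_self
  have n1 : (L.take k).Nodup := h1.imp ne_of_lt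
  have n3 : (L.drop (k + 1)).Nodup := h3.imp ne_of_lt
  rw [List.eraseIdx_eq_take_drop_succ, List.toFinset_append, Finset.filter_union,
    Finset.filter_union]
  constructor
  · rw [Finset.filter_true_of_mem (by simpa using hlt),
      Finset.filter_false_of_mem (by simpa using fun i hi => (h2 i hi).le), Finset.union_empty,
      List.toFinset_card_of_nodup n1, List.length_take]
    omega
  · rw [Finset.filter_false_of_mem (by simpa using fun i hi => (hlt i hi).le),
      Finset.filter_true_of_mem (by simpa using h2), Finset.empty_union,
      List.toFinset_card_of_nodup n3, List.length_drop]
    omega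

/-- In an open partition the points of `L` are the right end points at or after `m`. -/
theorem card_filter_blocks {m : ℕ} {L : List (Fin M)} (hLm : ∀ i ∈ L, m ≤ (i : ℕ))
    {V : Finset (Fin M × Fin M)} (hV : V ∈ openPartitions m L) (P : Fin M → Prop)
    [DecidablePred P] :
    (V.filter fun p => m ≤ (p.2 : ℕ) ∧ P p.2).card = (L.toFinset.filter P).card := by
  obtain ⟨h1, h2⟩ := mem_openPartitions.1 hV
  refine Finset.card_bij (fun p _ => p.2) ?_ ?_ ?_
  · intro p hp
    obtain ⟨hp, hm, hP⟩ := Finset.mem_filter.1 hp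
    refine Finset.mem_filter.2 ⟨List.mem_toFinset.2 ?_, hP⟩
    exact ((h1.1 p hp).2.2).resolve_left hm.not_gt
  · intro p hp r hr e
    exact h1.eq_of_mem (Finset.mem_filter.1 hp).1 (Finset.mem_filter.1 hr).1 (Or.inr rfl)
      (Or.inr e)
  · intro i hi
    obtain ⟨hi, hP⟩ := Finset.mem_filter.1 hi
    rw [List.mem_toFinset] at hi
    obtain ⟨p, ⟨hp, hip⟩, -⟩ := h1.2 i (Or.inr hi)
    rcases hip with rfl | rfl
    · exact absurd (h2 p hp) (hLm _ hi).not_gt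
    · exact ⟨p, Finset.mem_filter.2 ⟨hp, hLm _ hi, hP⟩, rfl⟩

theorem block_notMem {m : Fin M} {L : List (Fin M)} {V : Finset (Fin M × Fin M)}
    (hV : V ∈ openPartitions m L) (t : Fin M) : (m, t) ∉ V := fun h =>
  absurd ((mem_openPartitions.1 hV).2 _ h) (lt_irrefl _)

/-- The change of the statistic `e₀` when a block between `m` and the `k`-th point of `L` is
added. -/
theorem e0_insert {m : Fin M} {L : List (Fin M)} (hL : L.Pairwise (· < ·))
    (hLm : ∀ i ∈ L, m < i) (k : Fin L.length) {V : Finset (Fin M × Fin M)}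
    (hV : V ∈ openPartitions m (L.eraseIdx k)) :
    e0 (insert (m, L.get k) V) = L.length - 1 + k + e0 V := by
  set t := L.get k with ht
  have hmt : m < t := hLm _ (List.get_mem _ _)
  have hnot : (m, t) ∉ V := block_notMem hV t
  have hL' : ∀ i ∈ L.eraseIdx k, (m : ℕ) ≤ (i : ℕ) := fun i hi =>
    Fin.le_def.1 (hLm i (List.mem_of_mem_eraseIdx hi)).le
  have hopen := (mem_openPartitions.1 hV).2
  have htL : t ∉ L.eraseIdx k := fun h => ((mem_eraseIdx_iff_of_sortedLT hL k t).1 h).2 rfl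
  have hone := (mem_openPartitions.1 hV).1
  have hne : ∀ p ∈ V, p.2 ≠ m := by
    rintro p hp rfl
    rcases (hone.1 p hp).2.2 with h | h
    · exact lt_irrefl _ h
    · exact lt_irrefl _ (hLm _ (List.mem_of_mem_eraseIdx h))
  have hcr : cr (insert (m, t) V) = k + cr V := by
    rw [cr_eq_sum, Finset.sum_insert hnot, Finset.sum_insert hnot, cr_eq_sum,
      Finset.sum_congr rfl fun p _ => Finset.sum_insert hnot, Finset.sum_add_distrib]
    -- All old blocks begin before `m`, so the new block is never the earlier one of a pair.
    have h1 : (∑ d ∈ V, if m < d.1 ∧ d.1 < t ∧ t < d.2 then 1 else 0) = 0 := by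
      refine Finset.sum_eq_zero fun d hd => if_neg fun h => ?_
      exact absurd (hopen d hd) (Fin.lt_def.1 h.1).not_gt
    -- The old blocks crossed by `(m, t)` are those whose right end is an open point below `t`.
    have h2 : (∑ p ∈ V, if p.1 < m ∧ m < p.2 ∧ p.2 < t then 1 else 0) = (k : ℕ) := by
      rw [← Finset.card_filter, ← (card_filter_eraseIdx hL k).1,
        ← card_filter_blocks hL' hV]
      congr 1
      refine Finset.filter_congr fun p hp => ?_
      have := hopen p hp
      have := hne p hp
      simp only [Fin.lt_def, ne_eq, Fin.ext_iff] at *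
      omega
    simp only [lt_irrefl, false_and, if_false]
    simp only [h1, h2]
    omega
  have hpbr : pbr (insert (m, t) V) = L.length - 1 - k + pbr V := by
    rw [pbr_eq_sum, Finset.sum_insert hnot, Finset.sum_insert hnot, pbr_eq_sum,
      Finset.sum_congr rfl fun p _ => Finset.sum_insert hnot, Finset.sum_add_distrib]
    have h1 : (∑ d ∈ V, if m < d.1 ∧ d.1 < d.2 ∧ d.2 < t then 1 else 0) = 0 := by
      refine Finset.sum_eq_zero fun d hd => if_neg fun h => ?_
      exact absurd (hopen d hd) (Fin.lt_def.1 h.1).not_gt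
    have h2 : (∑ p ∈ V, if p.1 < m ∧ m < t ∧ t < p.2 then 1 else 0) = L.length - 1 - (k : ℕ) := by
      rw [← Finset.card_filter, ← (card_filter_eraseIdx hL k).2,
        ← card_filter_blocks hL' hV]
      congr 1
      refine Finset.filter_congr fun p hp => ?_
      have := hopen p hp
      simp only [Fin.lt_def] at *
      omega
    simp only [lt_irrefl, false_and, if_false]
    simp only [h1, h2]
    omega
  -- `(ℓ - 1 - k) + 2 k = ℓ - 1 + k` with `ℓ = L.length`; the bound `k < ℓ` makes the truncated
  -- subtraction exact.
  have := k.2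
  rw [e0, e0, hcr, hpbr]
  omega

theorem insert_mem_openPartitions {m : Fin M} {L : List (Fin M)} (hL : L.Pairwise (· < ·))
    (hLm : ∀ i ∈ L, m < i) (k : Fin L.length) {V : Finset (Fin M × Fin M)}
    (hV : V ∈ openPartitions m (L.eraseIdx k)) :
    insert (m, L.get k) V ∈ openPartitions (m + 1) L := by
  obtain ⟨h1, h2⟩ := mem_openPartitions.1 hV
  have hkL : L.get k ∈ L := List.get_mem _ _
  have hmt : m < L.get k := hLm _ hkL
  have hmA : m ∉ pointSet m (L.eraseIdx k) := by
    rintro (h | h)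
    · exact lt_irrefl _ h
    · exact lt_irrefl _ (hLm _ (List.mem_of_mem_eraseIdx h))
  have htA : L.get k ∉ pointSet m (L.eraseIdx k) := by
    rintro (h | h)
    · exact absurd h (Fin.lt_def.1 hmt).not_gt
    · exact ((mem_eraseIdx_iff_of_sortedLT hL k _).1 h).2 rfl
  refine mem_openPartitions.2 ⟨?_, ?_⟩
  · convert h1.insert hmt hmA htA using 1
    rw [pointSet_succ]
    ext i
    simp only [pointSet, Set.mem_ofPred_eq, List.mem_cons, Set.mem_union, Set.mem_insert_iff,
      Set.mem_singleton_iff, mem_eraseIdx_iff_of_sortedLT hL]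
    by_cases h : i = L.get k
    · simp [h]
    · simp only [h]; tauto
  · intro p hp
    rcases Finset.mem_insert.1 hp with rfl | hp
    · exact Nat.lt_succ_self _
    · exact (h2 p hp).trans (Nat.lt_succ_self _)

theorem erase_mem_openPartitions {m : Fin M} {L : List (Fin M)} (hL : L.Pairwise (· < ·))
    (hLm : ∀ i ∈ L, m < i) (k : Fin L.length) {V : Finset (Fin M × Fin M)}
    (hV : V ∈ openPartitions (m + 1) L) (hk : (m, L.get k) ∈ V) :
    V.erase (m, L.get k) ∈ openPartitions m (L.eraseIdx k) := by
  obtain ⟨h1, h2⟩ := mem_openPartitions.1 hV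
  have hkL : L.get k ∈ L := List.get_mem _ _
  have hmt : m < L.get k := hLm _ hkL
  refine mem_openPartitions.2 ⟨?_, ?_⟩
  · convert h1.erase hk using 1
    rw [pointSet_succ]
    ext i
    simp only [pointSet, Set.mem_ofPred_eq, List.mem_cons, Set.mem_sdiff, Set.mem_insert_iff,
      Set.mem_singleton_iff, mem_eraseIdx_iff_of_sortedLT hL]
    have e1 : (i : ℕ) < m → i ≠ m := fun h e => by simp [e] at h
    have e2 : (i : ℕ) < m → i ≠ L.get k := fun h e => by
      rw [e] at h; exact absurd h (Fin.lt_def.1 hmt).not_gt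
    have e3 : i ∈ L → i ≠ m := fun h e => by
      rw [e] at h; exact lt_irrefl _ (hLm _ h)
    tauto
  · intro p hp
    have hp' := Finset.mem_of_mem_erase hp
    refine lt_of_le_of_ne (Nat.lt_succ_iff.1 (h2 p hp')) fun e => ?_
    exact Finset.ne_of_mem_erase hp
      (h1.eq_of_mem hp' hk (Or.inl rfl) (Or.inl (Fin.ext e)))

/-- The underlying point sets coincide by `pointSet_succ`; only the condition on left end points
differs. -/
theorem mem_openPartitions_cons {m : Fin M} {L : List (Fin M)} {V : Finset (Fin M × Fin M)} :
    V ∈ openPartitions m (m :: L) ↔ V ∈ openPartitions (m + 1) L ∧ ∀ p ∈ V, p.1 ≠ m := by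
  rw [mem_openPartitions, mem_openPartitions, pointSet_succ, and_assoc]
  refine and_congr_right fun _ => ⟨fun h => ⟨fun p hp => (h p hp).trans (Nat.lt_succ_self _),
    fun p hp e => ?_⟩, fun h p hp => ?_⟩
  · exact absurd (h p hp) (by rw [e]; exact lt_irrefl _)
  · exact lt_of_le_of_ne (Nat.lt_succ_iff.1 (h.1 p hp)) fun e => h.2 p hp (Fin.ext e)

/-- Split by the role of `m`. If no block begins there, `m` is a right end and joins the open
points. Otherwise its partner lies after `m`, hence in `L`, and removing that block is a bijection.
The two cases mirror creation and annihilation. -/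
theorem sum_openPartitions_succ {R : Type*} [AddCommMonoid R] {m : Fin M} {L : List (Fin M)}
    (hL : L.Pairwise (· < ·)) (hLm : ∀ i ∈ L, m < i) (F : Finset (Fin M × Fin M) → R) :
    ∑ V ∈ openPartitions (m + 1) L, F V = ∑ V ∈ openPartitions m (m :: L), F V +
      ∑ k : Fin L.length, ∑ V ∈ openPartitions m (L.eraseIdx k), F (insert (m, L.get k) V) := by
  classical
  rw [← Finset.sum_filter_add_sum_filter_not (openPartitions (m + 1) L)
    (fun V => ∀ p ∈ V, p.1 ≠ m)]
  congr 1
  · refine Finset.sum_congr ?_ fun _ _ => rfl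
    ext V
    rw [Finset.mem_filter, mem_openPartitions_cons]
  · rw [Finset.sum_sigma']
    symm
    refine Finset.sum_bij (fun x _ => insert (m, L.get x.1) x.2) ?_ ?_ ?_ fun _ _ => rfl
    · rintro ⟨k, V⟩ hV
      simp only [Finset.mem_sigma, Finset.mem_univ, true_and] at hV
      refine Finset.mem_filter.2 ⟨insert_mem_openPartitions hL hLm k hV, fun h => ?_⟩
      exact h _ (Finset.mem_insert_self _ _) rfl
    · rintro ⟨k, V⟩ hV ⟨l, W⟩ hW e
      simp only [Finset.mem_sigma, Finset.mem_univ, true_and] at hV hW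
      change insert (m, L.get k) V = insert (m, L.get l) W at e
      have h1 : (m, L.get k) ∈ insert (m, L.get l) W := e ▸ Finset.mem_insert_self _ _
      have hkl : L.get k = L.get l := by
        rcases Finset.mem_insert.1 h1 with h | h
        · exact (Prod.ext_iff.1 h).2
        · exact absurd h (block_notMem hW _)
      have hnd : L.Nodup := hL.imp ne_of_lt
      obtain rfl : k = l := List.nodup_iff_injective_get.1 hnd hkl
      have : V = W := by
        rw [← Finset.erase_insert (block_notMem hV (L.get k)), e,
          Finset.erase_insert (block_notMem hW _)]
      rw [this]
    · intro V hV
      obtain ⟨hV, hm⟩ := Finset.mem_filter.1 hV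
      push Not at hm
      obtain ⟨⟨a, t⟩, hp, rfl⟩ := hm
      have h1 := (mem_openPartitions.1 hV).1.1 _ hp
      have htL : t ∈ L := h1.2.2.resolve_left fun h => by
        have := Fin.lt_def.1 h1.1
        simp only at h this
        omega
      obtain ⟨k, rfl⟩ := List.get_of_mem htL
      exact ⟨⟨k, V.erase (a, L.get k)⟩, by
        simpa using erase_mem_openPartitions hL hLm k hV hp, Finset.insert_erase hp⟩

end PairPartitions

/-! ### The Wick formula -/

section Wick

variable {𝕜 H : Type*} [RCLike 𝕜] [NormedAddCommGroup H] [InnerProductSpace 𝕜 H]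

/-- The Wick formula in a form open to induction: `m` operators remain to act, and `L` lists the
uncontracted indices in increasing order. The rightmost operator either prefixes `m` to `L` or
contracts `m` with an entry of `L`. -/
theorem inner_vacuum_gaussian_prod_wordVec (q : unitInterval) {M : ℕ} (f : Fin M → H) (m : ℕ)
    (hm : m ≤ M) (L : List (Fin M)) (hL : L.Pairwise (· < ·)) (hLm : ∀ i ∈ L, m ≤ (i : ℕ)) :
    inner 𝕜 (vacuum 𝕜 H q : Fock 𝕜 H q)
      ((List.ofFn fun i : Fin m => gaussian (𝕜 := 𝕜) q (f (Fin.castLE hm i))).prod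
        (wordVec 𝕜 q (L.map f)) : Fock 𝕜 H q) =
    ∑ V ∈ openPartitions m L, ((q : ℝ) : 𝕜) ^ e0 V * ∏ p ∈ V, inner 𝕜 (f p.1) (f p.2) := by
  induction m generalizing L with
  | zero =>
    rw [openPartitions_zero, List.ofFn_zero, List.prod_nil, Module.End.one_apply,
      inner_vacuum_wordVec]
    by_cases h : L = [] <;> simp [h, e0, cr, pbr]
  | succ m ih =>
    have hLm' : ∀ i ∈ L, (⟨m, hm⟩ : Fin M) < i := fun i hi => Fin.lt_def.2 (hLm i hi)
    rw [sum_openPartitions_succ (m := ⟨m, hm⟩) hL hLm', List.ofFn_succ_last, List.prod_append,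
      List.prod_singleton, Module.End.mul_apply, gaussian, LinearMap.add_apply,
      creation_wordVec, annihilation_wordVec, add_comm (Finset.sum _ _), map_add,
      Submodule.coe_add, inner_add_right]
    congr 1
    · refine Eq.trans ?_ (ih (by omega) (⟨m, hm⟩ :: L) (List.pairwise_cons.2 ⟨hLm', hL⟩) ?_)
      · rfl
      · intro i hi
        rcases List.mem_cons.1 hi with rfl | hi
        · exact le_rfl
        · exact (Nat.le_succ m).trans (hLm i hi)
    · rw [map_sum, Submodule.coe_sum, inner_sum]
      have hlen : (L.map f).length = L.length := List.length_map f
      rw [← Equiv.sum_comp (finCongr hlen)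
        (fun k => ∑ V ∈ openPartitions m (L.eraseIdx k), _)]
      refine Finset.sum_congr rfl fun k _ => ?_
      set l : Fin L.length := finCongr hlen k with hl
      have hkl : (k : ℕ) = l := rfl
      rw [map_smul, Submodule.coe_smul, inner_smul_right, List.eraseIdx_map]
      have := ih (by omega) (L.eraseIdx k) (hL.sublist (List.eraseIdx_sublist _ _))
        fun i hi => (Nat.le_succ m).trans (hLm i (List.mem_of_mem_eraseIdx hi))
      refine (congrArg _ this).trans ?_
      rw [Finset.mul_sum]
      refine Finset.sum_congr rfl fun V hV => ?_
      have hget : (L.map f).get k = f (L.get l) := by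
        simp only [List.get_eq_getElem, List.getElem_map]
        rfl
      have hlast : Fin.castLE hm (Fin.last m) = ⟨m, hm⟩ := rfl
      -- The annihilation weight is exactly the growth of `e0` caused by the new block.
      rw [e0_insert (m := ⟨m, hm⟩) hL hLm' l hV,
        Finset.prod_insert (block_notMem (m := ⟨m, hm⟩) hV _), hget, hlast, hkl, List.length_map]
      ring

theorem vacuumExpectation_gaussian_prod (q : unitInterval) {M : ℕ} (f : Fin M → H) :
    vacuumExpectation (List.ofFn fun i => gaussian (𝕜 := 𝕜) q (f i)).prod =
      ∑ V ∈ pairPartitions M,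
        ((q : ℝ) : 𝕜) ^ e0 V * ∏ p ∈ V, inner 𝕜 (f p.1) (f p.2) := by
  rw [← openPartitions_full, ← inner_vacuum_gaussian_prod_wordVec q f M le_rfl []
    List.Pairwise.nil (by simp)]
  simp only [vacuumExpectation, List.map_nil, ← vacuum_eq_wordVec]
  rfl

end Wick

/-! ### Hermite polynomials and the `q`-derivative -/

section Hermite

open Polynomial

theorem qInt_succ (q : ℝ) (n : ℕ) : qInt q (n + 1) = 1 + q * qInt q n := by
  rw [qInt, Finset.sum_range_succ', qInt, Finset.mul_sum, add_comm]
  simp [pow_succ']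

theorem X_mul_hermiteI (q : ℝ) (n : ℕ) :
    X * hermiteI q (n + 1) = hermiteI q (n + 2) + C (q ^ n * qInt q (n + 1)) * hermiteI q n := by
  rw [hermiteI]
  ring

/-- The span contains `1` and, by the recursion, is stable under multiplication by `X`. -/
theorem span_hermiteI (q : ℝ) : Submodule.span ℝ (Set.range (hermiteI q)) = ⊤ := by
  have hmem : ∀ n, hermiteI q n ∈ Submodule.span ℝ (Set.range (hermiteI q)) := fun n =>
    Submodule.subset_span ⟨n, rfl⟩
  have hX : ∀ p ∈ Submodule.span ℝ (Set.range (hermiteI q)),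
      X * p ∈ Submodule.span ℝ (Set.range (hermiteI q)) := by
    intro p hp
    induction hp using Submodule.span_induction with
    | mem p hp =>
      obtain ⟨n, rfl⟩ := hp
      cases n with
      | zero => simpa [hermiteI] using hmem 1
      | succ n =>
        rw [X_mul_hermiteI, ← smul_eq_C_mul]
        exact add_mem (hmem _) (Submodule.smul_mem _ _ (hmem _))
    | zero => simp
    | add p r _ _ hp hr => rw [mul_add]; exact add_mem hp hr
    | smul c p _ hp => rw [mul_smul_comm]; exact Submodule.smul_mem _ _ hp
  have hpow : ∀ n, (X ^ n : ℝ[X]) ∈ Submodule.span ℝ (Set.range (hermiteI q)) := by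
    intro n
    induction n with
    | zero => simpa [hermiteI] using hmem 0
    | succ n ih => rw [pow_succ']; exact hX _ ih
  refine Submodule.eq_top_iff'.2 fun p => ?_
  rw [p.as_sum_range_C_mul_X_pow]
  refine sum_mem fun n _ => ?_
  rw [← smul_eq_C_mul]
  exact Submodule.smul_mem _ _ (hpow n)

/-- The `q`-derivative `xⁿ ↦ [n]_q xⁿ⁻¹`. -/
def qDerivative (q : ℝ) : ℝ[X] →ₗ[ℝ] ℝ[X] :=
  lsum fun n => qInt q n • monomial (n - 1)

theorem qDerivative_monomial (q : ℝ) (n : ℕ) (a : ℝ) :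
    qDerivative q (monomial n a) = monomial (n - 1) (qInt q n * a) := by
  simp [qDerivative, lsum_apply, smul_monomial]

theorem qDerivative_X_pow (q : ℝ) (n : ℕ) :
    qDerivative q (X ^ n) = C (qInt q n) * X ^ (n - 1) := by
  rw [X_pow_eq_monomial, qDerivative_monomial, mul_one, C_mul_X_pow_eq_monomial]

theorem qDerivative_X_mul (q : ℝ) (p : ℝ[X]) :
    qDerivative q (X * p) = p + C q * (X * qDerivative q p) := by
  induction p using Polynomial.induction_on' with
  | add p r hp hr => simp only [mul_add, map_add, hp, hr]; ring
  | monomial n a =>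
    rw [X_mul_monomial, qDerivative_monomial, qDerivative_monomial, X_mul_monomial,
      C_mul_monomial, qInt_succ]
    cases n with
    -- Here the truncated degree `0 - 1` occurs, with coefficient `[0]_q = 0`.
    | zero => simp [qInt]
    | succ n =>
      simp only [Nat.add_sub_cancel, ← map_add]
      congr 1
      ring

theorem qDerivative_C_mul (q c : ℝ) (p : ℝ[X]) :
    qDerivative q (C c * p) = C c * qDerivative q p := by
  rw [← smul_eq_C_mul, map_smul, smul_eq_C_mul]

/-- The Appell property. Differentiating the recursion by the `q`-Leibniz rule and expanding `x
hₙ₊₁` again, the `hₙ` terms cancel because `q * q ^ n = q ^ (n + 1)`; what is left is `1 + q [n +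
2]_q = [n + 3]_q`. -/
theorem qDerivative_hermiteI_succ (q : ℝ) (n : ℕ) :
    qDerivative q (hermiteI q (n + 1)) = C (qInt q (n + 1)) * hermiteI q n := by
  induction n using Nat.strong_induction_on with
  | _ n ih =>
    match n with
    | 0 =>
      have := qDerivative_X_pow q 1
      simpa [hermiteI] using this
    | 1 =>
      have h0 : qDerivative q (1 : ℝ[X]) = 0 := by
        have := qDerivative_X_pow q 0
        simpa [qInt] using this
      have h1 := ih 0 zero_lt_one
      rw [show hermiteI q (1 + 1) = X * hermiteI q (0 + 1) - C (q ^ 0 * qInt q 1) * hermiteI q 0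
        from rfl, map_sub, qDerivative_X_mul, qDerivative_C_mul, h1]
      simp only [hermiteI, h0, qInt_succ q 1, map_add, map_one, map_mul, mul_zero, mul_one]
      ring
    | n + 2 =>
      have h1 := ih (n + 1) (by omega)
      have h2 := ih n (by omega)
      have hx : X * hermiteI q (n + 1) =
        hermiteI q (n + 2) + C (q ^ n * qInt q (n + 1)) * hermiteI q n := X_mul_hermiteI q n
      rw [hermiteI, map_sub, qDerivative_X_mul, qDerivative_C_mul, h1, h2,
        mul_left_comm X, hx, qInt_succ q (n + 2)]
      simp only [map_add, map_one, map_mul, map_pow]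
      ring

variable {E : Type*} [AddCommGroup E] [Module ℝ E]

theorem linearMap_ext_hermiteI (q : ℝ) {Λ Λ' : ℝ[X] →ₗ[ℝ] E} (h0 : Λ 1 = Λ' 1)
    (h : ∀ n, Λ (hermiteI q (n + 1)) = 0) (h' : ∀ n, Λ' (hermiteI q (n + 1)) = 0) : Λ = Λ' := by
  refine LinearMap.ext_on (span_hermiteI q) ?_
  rintro _ ⟨n, rfl⟩
  cases n with
  | zero => exact h0
  | succ n => rw [h, h']

/-- A functional that kills all Hermite polynomials but the first intertwines multiplication by
`x` and the `q`-derivative. -/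
theorem apply_X_mul_eq_qDerivative {q : ℝ} {Λ : ℝ[X] →ₗ[ℝ] E}
    (h : ∀ n, Λ (hermiteI q (n + 1)) = 0) (p : ℝ[X]) : Λ (X * p) = Λ (qDerivative q p) := by
  have : Λ ∘ₗ LinearMap.mulLeft ℝ X = Λ ∘ₗ qDerivative q := by
    refine LinearMap.ext_on (span_hermiteI q) ?_
    rintro _ ⟨n, rfl⟩
    simp only [LinearMap.comp_apply, LinearMap.mulLeft_apply]
    cases n with
    | zero =>
      have h0 : qDerivative q (1 : ℝ[X]) = 0 := by
        have := qDerivative_X_pow q 0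
        simpa [qInt] using this
      have := h 0
      simpa [hermiteI, h0] using this
    | succ n =>
      rw [X_mul_hermiteI, qDerivative_hermiteI_succ, map_add, h, zero_add, ← smul_eq_C_mul,
        ← smul_eq_C_mul, map_smul, map_smul]
      -- Both sides are multiples of `Λ hₙ`: for `n = 0` the factors agree since `q ^ 0 = 1`, and
      -- for `n > 0` both vanish.
      cases n with
      | zero => simp
      | succ n => simp [h]
  exact LinearMap.congr_fun this p

/-- Converse of `apply_X_mul_eq_qDerivative`, used to recognise a Hermite measure from its moments.
-/
theorem apply_hermiteI_succ_eq_zero {q : ℝ} {Λ : ℝ[X] →ₗ[ℝ] E}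
    (h : ∀ p, Λ (X * p) = Λ (qDerivative q p)) (n : ℕ) : Λ (hermiteI q (n + 1)) = 0 := by
  induction n using Nat.twoStepInduction with
  | zero =>
    have h0 : qDerivative q (1 : ℝ[X]) = 0 := by
      have := qDerivative_X_pow q 0
      simpa [qInt] using this
    have := h 1
    simpa [hermiteI, h0] using this
  | one =>
    rw [hermiteI, map_sub, h, qDerivative_hermiteI_succ]
    simp
  | more n h1 _ =>
    rw [hermiteI, map_sub, h, qDerivative_hermiteI_succ, ← smul_eq_C_mul, ← smul_eq_C_mul,
      map_smul, map_smul, h1]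
    simp

theorem apply_X_pow_two_mul {q : ℝ} {Λ : ℝ[X] →ₗ[ℝ] E}
    (h : ∀ n, Λ (hermiteI q (n + 1)) = 0) (n : ℕ) :
    Λ (X ^ (2 * n)) = (∏ k ∈ Finset.range n, qInt q (2 * k + 1)) • Λ 1 := by
  induction n with
  | zero => simp
  | succ n ih =>
    rw [show 2 * (n + 1) = (2 * n + 1) + 1 by ring, pow_succ', apply_X_mul_eq_qDerivative h,
      qDerivative_X_pow, ← smul_eq_C_mul, map_smul, Nat.add_sub_cancel, ih,
      Finset.prod_range_succ, smul_smul, mul_comm]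

end Hermite

/-! ### The vacuum functional of a Gaussian -/

section VacuumFunctional

open Polynomial

variable {𝕜 H : Type*} [RCLike 𝕜] [NormedAddCommGroup H] [InnerProductSpace 𝕜 H]

variable (𝕜) in
/-- The functional `p ↦ ⟨Ω, p(G(f)) Ω⟩` on real polynomials. -/
def vacuumFunctional (q : unitInterval) (f : H) : ℝ[X] →ₗ[ℝ] 𝕜 where
  toFun p := vacuumExpectation (aeval (gaussian (𝕜 := 𝕜) q f) (p.map (algebraMap ℝ 𝕜)))
  map_add' p r := by
    simp [vacuumExpectation, inner_add_right]
  map_smul' c p := by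
    simp [vacuumExpectation, inner_smul_right, Algebra.smul_def]

theorem vacuumFunctional_apply (q : unitInterval) (f : H) (p : ℝ[X]) :
    vacuumFunctional 𝕜 q f p =
      vacuumExpectation (aeval (gaussian (𝕜 := 𝕜) q f) (p.map (algebraMap ℝ 𝕜))) := rfl

theorem vacuumFunctional_X_pow (q : unitInterval) (f : H) (k : ℕ) :
    vacuumFunctional 𝕜 q f (X ^ k) = vacuumExpectation (gaussian (𝕜 := 𝕜) q f ^ k) := by
  simp [vacuumFunctional_apply]

theorem vacuumFunctional_one (q : unitInterval) (f : H) : vacuumFunctional 𝕜 q f 1 = 1 := by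
  rw [vacuumFunctional_apply, Polynomial.map_one, map_one, vacuumExpectation,
    Module.End.one_apply]
  have := inner_vacuum_wordVec (𝕜 := 𝕜) (H := H) q []
  rwa [← vacuum_eq_wordVec, if_pos rfl] at this

theorem vacuumFunctional_hermiteI_succ (q : unitInterval) {f : H} (hf : ‖f‖ = 1) (n : ℕ) :
    vacuumFunctional 𝕜 q f (hermiteI q (n + 1)) = 0 := by
  rw [vacuumFunctional_apply, vacuumExpectation, aeval_hermiteI_gaussian_vacuum q hf,
    inner_vacuum_wordVec]
  simp

theorem vacuumExpectation_gaussian_pow (q : unitInterval) {f : H} (hf : ‖f‖ = 1) (n : ℕ) :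
    vacuumExpectation (gaussian (𝕜 := 𝕜) q f ^ (2 * n)) =
      ((∏ k ∈ Finset.range n, qInt q (2 * k + 1) : ℝ) : 𝕜) := by
  rw [← vacuumFunctional_X_pow, apply_X_pow_two_mul (vacuumFunctional_hermiteI_succ q hf),
    vacuumFunctional_one, Algebra.smul_def, mul_one]

theorem inner_aeval_gaussian_left {H : Type*} [NormedAddCommGroup H] [InnerProductSpace ℝ H]
    (q : unitInterval) (f : H) (p : ℝ[X]) (ξ η : finiteParticle ℝ H q) :
    inner ℝ (aeval (gaussian (𝕜 := ℝ) q f) p ξ) η =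
      inner ℝ ξ (aeval (gaussian (𝕜 := ℝ) q f) p η) := by
  induction p using Polynomial.induction_on' generalizing ξ η with
  | add p r hp hr =>
    simp only [map_add, LinearMap.add_apply, inner_add_left, inner_add_right, hp, hr]
  | monomial n a =>
    have : ∀ ξ η, inner ℝ ((gaussian (𝕜 := ℝ) q f ^ n) ξ) η =
        inner ℝ ξ ((gaussian (𝕜 := ℝ) q f ^ n) η) := by
      induction n with
      | zero => simp
      | succ n ih =>
        intro ξ η
        rw [pow_succ, Module.End.mul_apply, ih, inner_gaussian_left, ← Module.End.mul_apply,
          ← pow_succ', pow_succ]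
    simp [aeval_monomial, inner_smul_left, inner_smul_right, this]

/-- Since `G` is symmetric, `h_m(G)` moves to the other side of the inner product, which becomes
that of `f^{⊗ m}` and `f^{⊗ n}`; different particle numbers are orthogonal. -/
theorem vacuumFunctional_hermiteI_mul {H : Type*} [NormedAddCommGroup H] [InnerProductSpace ℝ H]
    (q : unitInterval) {f : H} (hf : ‖f‖ = 1) {m n : ℕ} (hmn : m ≠ n) :
    vacuumFunctional ℝ q f (hermiteI q m * hermiteI q n) = 0 := by
  have key : ∀ n, aeval (gaussian (𝕜 := ℝ) q f) (hermiteI q n) (vacuum ℝ H q) =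
      wordVec ℝ q (List.replicate n f) := by
    intro n
    have := aeval_hermiteI_gaussian_vacuum (𝕜 := ℝ) q hf n
    rwa [Algebra.algebraMap_self, Polynomial.map_id] at this
  rw [vacuumFunctional_apply, Algebra.algebraMap_self, Polynomial.map_id, map_mul,
    vacuumExpectation, Module.End.mul_apply, key]
  have := inner_aeval_gaussian_left q f (hermiteI q m) (vacuum ℝ H q)
    (wordVec ℝ q (List.replicate n f))
  refine this.symm.trans ?_
  rw [key]
  exact inner_wordVec_of_length_ne q (by simpa using hmn)

end VacuumFunctional

/-! ### Hermite measures and their moments -/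

section Measures

open Polynomial MeasureTheory

theorem integrable_eval {μ : Measure ℝ} (h : ∀ k : ℕ, Integrable (fun x : ℝ => x ^ k) μ)
    (p : ℝ[X]) : Integrable (fun x => p.eval x) μ := by
  simp only [eval_eq_sum_range]
  exact integrable_finsetSum _ fun k _ => (h k).const_mul _

/-- Integration of polynomials against a measure with finite moments. -/
def momentFunctional {μ : Measure ℝ} (h : ∀ k : ℕ, Integrable (fun x : ℝ => x ^ k) μ) :
    ℝ[X] →ₗ[ℝ] ℝ where
  toFun p := ∫ x, p.eval x ∂μ
  map_add' p r := by
    simp only [eval_add]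
    exact integral_add (integrable_eval h p) (integrable_eval h r)
  map_smul' c p := by
    simp only [eval_smul, smul_eq_mul, integral_const_mul, RingHom.id_apply]

theorem momentFunctional_apply {μ : Measure ℝ}
    (h : ∀ k : ℕ, Integrable (fun x : ℝ => x ^ k) μ) (p : ℝ[X]) :
    momentFunctional h p = ∫ x, p.eval x ∂μ := rfl

theorem IsHermiteIMeasure.momentFunctional_one {q : ℝ} {μ : Measure ℝ}
    (h : IsHermiteIMeasure q μ) : momentFunctional h.integrable_pow 1 = 1 := by
  have := h.isProbabilityMeasure
  simp [momentFunctional_apply]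

theorem IsHermiteIMeasure.momentFunctional_hermiteI_succ {q : ℝ} {μ : Measure ℝ}
    (h : IsHermiteIMeasure q μ) (n : ℕ) :
    momentFunctional h.integrable_pow (hermiteI q (n + 1)) = 0 := by
  have := h.orthogonal (n + 1) 0 n.succ_ne_zero
  simpa [hermiteI, momentFunctional_apply] using this

theorem IsHermiteIMeasure.integral_pow_two_mul {q : ℝ} {μ : Measure ℝ}
    (h : IsHermiteIMeasure q μ) (n : ℕ) :
    ∫ x, x ^ (2 * n) ∂μ = ∏ k ∈ Finset.range n, qInt q (2 * k + 1) := by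
  have := apply_X_pow_two_mul h.momentFunctional_hermiteI_succ n
  simpa [h.momentFunctional_one, momentFunctional_apply] using this

/-- Both functionals are normalised and kill `hₙ` for `n ≥ 1`, so they agree on all polynomials.
Only orthogonality to `h₀` is needed. -/
theorem IsHermiteIMeasure.vacuumExpectation_eq {𝕜 H : Type*} [RCLike 𝕜] [NormedAddCommGroup H]
    [InnerProductSpace 𝕜 H] {q : unitInterval} {μ : Measure ℝ} (h : IsHermiteIMeasure q μ)
    {f : H} (hf : ‖f‖ = 1) (k : ℕ) :
    vacuumExpectation (gaussian (𝕜 := 𝕜) q f ^ k) = ((∫ x, x ^ k ∂μ : ℝ) : 𝕜) := by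
  have : vacuumFunctional 𝕜 q f =
      Algebra.linearMap ℝ 𝕜 ∘ₗ momentFunctional h.integrable_pow := by
    refine linearMap_ext_hermiteI (q : ℝ) ?_ (vacuumFunctional_hermiteI_succ q hf) fun n => ?_
    · rw [vacuumFunctional_one, LinearMap.comp_apply, h.momentFunctional_one]
      simp
    · rw [LinearMap.comp_apply, h.momentFunctional_hermiteI_succ, map_zero]
  rw [← vacuumFunctional_X_pow, this, LinearMap.comp_apply, momentFunctional_apply]
  simp

/-- A probability measure is a type I discrete `q`-Hermite measure as soon as its moments satisfy
the recursion `m₁ = 0`, `mₖ₊₂ = [k + 1]_q mₖ`. -/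
theorem isHermiteIMeasure_of_moments (q : unitInterval) {μ : Measure ℝ}
    (hμ : IsProbabilityMeasure μ) (hint : ∀ k : ℕ, Integrable (fun x : ℝ => x ^ k) μ)
    (h1 : ∫ x, x ∂μ = 0)
    (h2 : ∀ k : ℕ, ∫ x, x ^ (k + 2) ∂μ = qInt q (k + 1) * ∫ x, x ^ k ∂μ) :
    IsHermiteIMeasure q μ := by
  refine ⟨hμ, hint, fun m n hmn => ?_⟩
  -- On monomials this is the moment recursion.
  have hD : ∀ p, momentFunctional hint (X * p) = momentFunctional hint (qDerivative q p) := by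
    intro p
    induction p using Polynomial.induction_on' with
    | add p r hp hr => simp only [mul_add, map_add, hp, hr]
    | monomial n a =>
      rw [X_mul_monomial, qDerivative_monomial, momentFunctional_apply, momentFunctional_apply]
      simp only [eval_monomial, integral_const_mul]
      cases n with
      | zero => simp [h1, qInt]
      | succ n =>
        rw [h2, Nat.add_sub_cancel]
        ring
  have h := apply_hermiteI_succ_eq_zero hD
  have hf : ‖(1 : ℝ)‖ = 1 := norm_one
  -- The Fock space over the line `ℝ` is a model of the moments in which pairwise orthogonality is
  -- already known.
  have : momentFunctional hint = vacuumFunctional ℝ q (1 : ℝ) := by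
    refine linearMap_ext_hermiteI (q : ℝ) ?_ h (vacuumFunctional_hermiteI_succ q hf)
    rw [vacuumFunctional_one, momentFunctional_apply]
    simp
  have := (LinearMap.congr_fun this _).trans (vacuumFunctional_hermiteI_mul q hf hmn)
  simpa [momentFunctional_apply] using this

end Measures

/-! ### Existence for `q = 1`: the standard normal law -/

section Gaussian

open MeasureTheory ProbabilityTheory Real

theorem integrable_pow_mul_exp_neg_sq_div_two (k : ℕ) :
    Integrable fun x : ℝ => x ^ k * rexp (-x ^ 2 / 2) := by
  have := integrable_rpow_mul_exp_neg_mul_sq (b := 1 / 2) (by norm_num) (s := (k : ℝ))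
    (by have : (0 : ℝ) ≤ k := k.cast_nonneg
        linarith)
  simp only [rpow_natCast] at this
  refine this.congr (ae_of_all _ fun x => ?_)
  dsimp only
  congr 2
  ring

theorem hasDerivAt_exp_neg_sq_div_two (x : ℝ) :
    HasDerivAt (fun x : ℝ => rexp (-x ^ 2 / 2)) (-(x * rexp (-x ^ 2 / 2))) x := by
  have h : HasDerivAt (fun x : ℝ => -x ^ 2 / 2) (-x) x :=
    ((hasDerivAt_pow 2 x).neg.div_const 2).congr_deriv (by push_cast; ring)
  exact h.exp.congr_deriv (by ring)

theorem integral_mul_exp_neg_sq_div_two : ∫ x : ℝ, x * rexp (-x ^ 2 / 2) = 0 := by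
  have h := integral_eq_zero_of_hasDerivAt_of_integrable
    (fun x : ℝ => hasDerivAt_exp_neg_sq_div_two x)
    (by simpa using (integrable_pow_mul_exp_neg_sq_div_two 1).neg)
    (by simpa using integrable_pow_mul_exp_neg_sq_div_two 0)
  rwa [integral_neg, neg_eq_zero] at h

/-- Integration by parts: the derivative of `x ^ (k + 1) * exp (-x ^ 2 / 2)` has integral zero. -/
theorem integral_pow_add_two_mul_exp_neg_sq_div_two (k : ℕ) :
    ∫ x : ℝ, x ^ (k + 2) * rexp (-x ^ 2 / 2) =
      (k + 1) * ∫ x : ℝ, x ^ k * rexp (-x ^ 2 / 2) := by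
  have hd : ∀ x : ℝ, HasDerivAt (fun x : ℝ => x ^ (k + 1) * rexp (-x ^ 2 / 2))
      ((k + 1) * (x ^ k * rexp (-x ^ 2 / 2)) - x ^ (k + 2) * rexp (-x ^ 2 / 2)) x := by
    intro x
    refine ((hasDerivAt_pow (k + 1) x).mul (hasDerivAt_exp_neg_sq_div_two x)).congr_deriv ?_
    push_cast
    ring
  have i1 := (integrable_pow_mul_exp_neg_sq_div_two k).const_mul ((k : ℝ) + 1)
  have i2 := integrable_pow_mul_exp_neg_sq_div_two (k + 2)
  have h := integral_eq_zero_of_hasDerivAt_of_integrable hd (i1.sub i2)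
    (integrable_pow_mul_exp_neg_sq_div_two (k + 1))
  rw [integral_sub i1 i2, integral_const_mul] at h
  linarith

theorem integral_gaussianReal_zero_one (g : ℝ → ℝ) :
    ∫ x, g x ∂(gaussianReal 0 1) = (√(2 * π))⁻¹ * ∫ x, g x * rexp (-x ^ 2 / 2) := by
  rw [integral_gaussianReal_eq_integral_smul one_ne_zero, ← integral_const_mul]
  refine integral_congr_ae (ae_of_all _ fun x => ?_)
  simp [gaussianPDFReal]
  ring

theorem exists_isHermiteIMeasure_one : ∃ μ, IsHermiteIMeasure ((1 : unitInterval) : ℝ) μ := by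
  refine ⟨gaussianReal 0 1, isHermiteIMeasure_of_moments 1 inferInstance (fun k => ?_) ?_
    fun k => ?_⟩
  · exact (memLp_id_gaussianReal (μ := 0) (v := 1) (k : NNReal)).integrable_norm_pow'
      |>.mono (by fun_prop) (ae_of_all _ fun x => by simp)
  · rw [integral_gaussianReal_zero_one, integral_mul_exp_neg_sq_div_two, mul_zero]
  · rw [integral_gaussianReal_zero_one, integral_gaussianReal_zero_one,
      integral_pow_add_two_mul_exp_neg_sq_div_two]
    simp [qInt]
    ring

end Gaussian

/-! ### Existence for `q < 1`: a discrete measure -/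

section Jackson

open MeasureTheory

/-- The finite product `(q²; q²)_k`. -/
def qSqPochhammer (q : ℝ) (k : ℕ) : ℝ := ∏ i ∈ Finset.range k, (1 - q ^ (2 * (i + 1)))

variable {q : ℝ}

theorem qSqPochhammer_pos (h0 : 0 ≤ q) (h1 : q < 1) (k : ℕ) : 0 < qSqPochhammer q k :=
  Finset.prod_pos fun _ _ => sub_pos.2 (pow_lt_one₀ h0 h1 (by omega))

theorem summable_eulerSeries (h0 : 0 ≤ q) (h1 : q < 1) {z : ℝ} (hz0 : 0 ≤ z) (hz1 : z < 1) :
    Summable fun k => z ^ k / qSqPochhammer q k := by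
  have hlim : Filter.Tendsto (fun k : ℕ => z / (1 - q ^ (2 * (k + 1)))) Filter.atTop
      (nhds (z / (1 - 0))) := by
    refine tendsto_const_nhds.div (tendsto_const_nhds.sub ?_) (by norm_num)
    refine (tendsto_pow_atTop_nhds_zero_of_lt_one h0 h1).comp ?_
    exact Filter.tendsto_atTop_mono (fun k => (by omega : k ≤ 2 * (k + 1))) Filter.tendsto_id
  -- Ratio test: the quotients of successive terms tend to `z`, so they are eventually at most this
  -- `r < 1`.
  obtain ⟨r, hr, hr1⟩ := exists_between hz1
  refine summable_of_ratio_norm_eventually_le (r := r) hr1 ?_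
  filter_upwards [hlim.eventually_le_const (by simpa using hr)] with k hk
  have hp := qSqPochhammer_pos h0 h1 k
  have hp' := qSqPochhammer_pos h0 h1 (k + 1)
  rw [Real.norm_of_nonneg (by positivity), Real.norm_of_nonneg (by positivity)]
  have : z ^ (k + 1) / qSqPochhammer q (k + 1) =
      z / (1 - q ^ (2 * (k + 1))) * (z ^ k / qSqPochhammer q k) := by
    rw [qSqPochhammer, Finset.prod_range_succ, ← qSqPochhammer, pow_succ', div_mul_div_comm,
      mul_comm (qSqPochhammer q k)]
  rw [this]
  exact mul_le_mul_of_nonneg_right hk (by positivity)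

/-- Euler's series `∑ zᵏ / (q²; q²)_k`. -/
def eulerSeries (q z : ℝ) : ℝ := ∑' k, z ^ k / qSqPochhammer q k

theorem eulerSeries_pos (h0 : 0 ≤ q) (h1 : q < 1) {z : ℝ} (hz0 : 0 ≤ z) (hz1 : z < 1) :
    0 < eulerSeries q z :=
  (summable_eulerSeries h0 h1 hz0 hz1).tsum_pos
    (fun k => div_nonneg (pow_nonneg hz0 k) (qSqPochhammer_pos h0 h1 k).le) 0
    (by simp [qSqPochhammer])

/-- The factor `1 - q ^ (2 * k)` in the `k`-th term of the difference cancels the last factor of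
`(q²; q²)_k`, leaving `z` times the preceding term. This equation drives the moment recursion. -/
theorem eulerSeries_mul (h0 : 0 ≤ q) (h1 : q < 1) {z : ℝ} (hz0 : 0 ≤ z) (hz1 : z < 1) :
    eulerSeries q (q ^ 2 * z) = (1 - z) * eulerSeries q z := by
  have hq2 : q ^ 2 ≤ 1 := pow_le_one₀ h0 h1.le
  have hs := summable_eulerSeries h0 h1 hz0 hz1
  have hs' := summable_eulerSeries h0 h1 (z := q ^ 2 * z) (by positivity)
    ((mul_le_of_le_one_left hz0 hq2).trans_lt hz1)
  have key : eulerSeries q z - eulerSeries q (q ^ 2 * z) = z * eulerSeries q z := by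
    rw [eulerSeries, eulerSeries, ← hs.tsum_sub hs', (hs.sub hs').tsum_eq_zero_add,
      ← tsum_mul_left]
    simp only [pow_zero, sub_self, zero_add]
    refine tsum_congr fun k => ?_
    have hp := (qSqPochhammer_pos h0 h1 k).ne'
    have hk : 1 - q ^ (2 * (k + 1)) ≠ 0 := (sub_pos.2 (pow_lt_one₀ h0 h1 (by omega))).ne'
    rw [qSqPochhammer, Finset.prod_range_succ, ← qSqPochhammer]
    field_simp
    ring
  linarith

/-- The mass of each of the points `± qᵏ / √(1 - q)`. -/
def jacksonWeight (q : ℝ) (k : ℕ) : ℝ := q ^ k / qSqPochhammer q k / (2 * eulerSeries q q)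

/-- The type I discrete `q`-Hermite measure for `q < 1`. -/
def jacksonMeasure (q : ℝ) : Measure ℝ :=
  Measure.sum fun k => ENNReal.ofReal (jacksonWeight q k) •
    (Measure.dirac (q ^ k / √(1 - q)) + Measure.dirac (-(q ^ k / √(1 - q))))

theorem jacksonWeight_nonneg (h0 : 0 ≤ q) (h1 : q < 1) (k : ℕ) : 0 ≤ jacksonWeight q k :=
  div_nonneg (div_nonneg (pow_nonneg h0 k) (qSqPochhammer_pos h0 h1 k).le)
    (mul_nonneg zero_le_two (eulerSeries_pos h0 h1 h0 h1).le)

/-- Since `qᵏ (qᵏ)ⁿ = (qⁿ⁺¹)ᵏ`, the moments are values of Euler's series. The factor `2` is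
compensated by the two signs. -/
theorem hasSum_jacksonWeight_mul_pow (h0 : 0 ≤ q) (h1 : q < 1) (n : ℕ) :
    HasSum (fun k => jacksonWeight q k * (q ^ k) ^ n)
      (eulerSeries q (q ^ (n + 1)) / (2 * eulerSeries q q)) := by
  have := (summable_eulerSeries h0 h1 (z := q ^ (n + 1)) (pow_nonneg h0 _)
    (pow_lt_one₀ h0 h1 n.succ_ne_zero)).hasSum.div_const (2 * eulerSeries q q)
  refine this.congr_fun fun k => ?_
  rw [jacksonWeight]
  ring

theorem isProbabilityMeasure_jacksonMeasure (h0 : 0 ≤ q) (h1 : q < 1) :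
    IsProbabilityMeasure (jacksonMeasure q) := by
  constructor
  have hS := eulerSeries_pos h0 h1 h0 h1
  have h := (hasSum_jacksonWeight_mul_pow h0 h1 0).mul_right 2
  simp only [pow_zero, mul_one, zero_add, pow_one] at h
  rw [jacksonMeasure, Measure.sum_apply _ MeasurableSet.univ]
  have : ∀ k, (ENNReal.ofReal (jacksonWeight q k) •
      (Measure.dirac (q ^ k / √(1 - q)) + Measure.dirac (-(q ^ k / √(1 - q))))) Set.univ =
      ENNReal.ofReal (jacksonWeight q k * 2) := by
    intro k
    rw [ENNReal.ofReal_mul (jacksonWeight_nonneg h0 h1 k)]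
    simp [mul_two]
  simp only [this]
  rw [← ENNReal.ofReal_tsum_of_nonneg
    (fun k => mul_nonneg (jacksonWeight_nonneg h0 h1 k) zero_le_two) h.summable, h.tsum_eq]
  rw [div_mul_eq_mul_div, mul_comm, div_self (by positivity), ENNReal.ofReal_one]

theorem integrable_pow_jacksonMeasure (h0 : 0 ≤ q) (h1 : q < 1) (n : ℕ) :
    Integrable (fun x : ℝ => x ^ n) (jacksonMeasure q) := by
  have := isProbabilityMeasure_jacksonMeasure h0 h1
  refine Integrable.of_bound (by fun_prop) ((1 / √(1 - q)) ^ n) ?_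
  have hb : ∀ k : ℕ, |q ^ k / √(1 - q)| ≤ 1 / √(1 - q) := by
    intro k
    rw [abs_of_nonneg (by positivity)]
    gcongr
    exact pow_le_one₀ h0 h1.le
  rw [jacksonMeasure, Measure.ae_sum_iff]
  intro k
  refine Measure.ae_smul_measure ?_ _
  rw [ae_add_measure_iff]
  constructor <;> rw [ae_dirac_eq, Filter.eventually_pure, norm_pow] <;>
    refine pow_le_pow_left₀ (norm_nonneg _) ?_ n
  · exact hb k
  · rw [norm_neg]; exact hb k

theorem hasSum_integral_pow_jacksonMeasure (h0 : 0 ≤ q) (h1 : q < 1) (n : ℕ) :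
    HasSum (fun k => jacksonWeight q k *
        ((q ^ k / √(1 - q)) ^ n + (-(q ^ k / √(1 - q))) ^ n))
      (∫ x, x ^ n ∂(jacksonMeasure q)) := by
  have := hasSum_integral_measure (integrable_pow_jacksonMeasure h0 h1 n)
  refine this.congr_fun fun k => ?_
  rw [integral_smul_measure, integral_add_measure, integral_dirac, integral_dirac,
    ENNReal.toReal_ofReal (jacksonWeight_nonneg h0 h1 k), smul_eq_mul]
  · exact integrable_dirac (by simp)
  · exact integrable_dirac (by simp)

theorem integral_odd_pow_jacksonMeasure (h0 : 0 ≤ q) (h1 : q < 1) {n : ℕ} (hn : Odd n) :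
    ∫ x, x ^ n ∂(jacksonMeasure q) = 0 := by
  refine (hasSum_integral_pow_jacksonMeasure h0 h1 n).unique ?_
  simp [hn.neg_pow]

theorem integral_even_pow_jacksonMeasure (h0 : 0 ≤ q) (h1 : q < 1) {n : ℕ} (hn : Even n) :
    ∫ x, x ^ n ∂(jacksonMeasure q) =
      eulerSeries q (q ^ (n + 1)) / eulerSeries q q / √(1 - q) ^ n := by
  have hS := (eulerSeries_pos h0 h1 h0 h1).ne'
  have h := (hasSum_jacksonWeight_mul_pow h0 h1 n).mul_right (2 / √(1 - q) ^ n)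
  refine ((hasSum_integral_pow_jacksonMeasure h0 h1 n).unique
    (h.congr_fun fun k => ?_)).trans ?_
  · rw [hn.neg_pow, div_pow]
    ring
  · field_simp

/-- Odd moments vanish by symmetry. For even `k`, `eulerSeries_mul` at `z = q ^ (k + 1)` gives the
factor `1 - q ^ (k + 1)`, and the scaling of the points divides it by `1 - q`, which makes `[k +
1]_q`. At `q = 0` the measure is the fair law on `± 1`. -/
theorem exists_isHermiteIMeasure (q : unitInterval) : ∃ μ, IsHermiteIMeasure q μ := by
  rcases eq_or_ne q 1 with rfl | hq
  · exact exists_isHermiteIMeasure_one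
  have h0 : 0 ≤ (q : ℝ) := q.2.1
  have h1 : (q : ℝ) < 1 := lt_of_le_of_ne q.2.2 fun h => hq (Subtype.ext h)
  refine ⟨jacksonMeasure q, isHermiteIMeasure_of_moments q
    (isProbabilityMeasure_jacksonMeasure h0 h1) (integrable_pow_jacksonMeasure h0 h1) ?_ ?_⟩
  · simpa using integral_odd_pow_jacksonMeasure h0 h1 (n := 1) odd_one
  · intro k
    rcases k.even_or_odd with hk | hk
    · have hs : √(1 - (q : ℝ)) ^ 2 = 1 - q := Real.sq_sqrt (by linarith)
      have hqk : (q : ℝ) ^ (k + 1) < 1 := pow_lt_one₀ h0 h1 k.succ_ne_zero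
      have hS := eulerSeries_mul h0 h1 (pow_nonneg h0 (k + 1)) hqk
      rw [integral_even_pow_jacksonMeasure h0 h1 hk,
        integral_even_pow_jacksonMeasure h0 h1 (hk.add even_two), pow_add _ k 2, hs,
        show (q : ℝ) ^ (k + 2 + 1) = q ^ 2 * q ^ (k + 1) by ring, hS, qInt,
        geom_sum_eq h1.ne]
      have e1 : 1 - (q : ℝ) ≠ 0 := by linarith
      have e2 : (q : ℝ) - 1 ≠ 0 := by linarith
      rw [← neg_div_neg_eq ((q : ℝ) ^ (k + 1) - 1), neg_sub, neg_sub]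
      field_simp
    · rw [integral_odd_pow_jacksonMeasure h0 h1 hk,
        integral_odd_pow_jacksonMeasure h0 h1 (hk.add_even even_two), mul_zero]

end Jackson

end QDiscrete

end

open QDiscrete in
theorem theorem5 {𝕜 H : Type*} [RCLike 𝕜] [NormedAddCommGroup H] [InnerProductSpace 𝕜 H]
    (q : unitInterval) :
    -- the Wick formula
    (∀ (n : ℕ) (f : Fin (2 * n) → H),
      vacuumExpectation (List.ofFn fun i => gaussian (𝕜 := 𝕜) q (f i)).prod =
        ∑ V ∈ pairPartitions (2 * n),
          (((q : ℝ) ^ ((ip V : ℝ) / 2 + (cr V : ℝ)) : ℝ) : 𝕜) *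
            ∏ p ∈ V, inner 𝕜 (f p.1) (f p.2)) ∧
    -- the vacuum distribution of a Gaussian and its even moments
    (∃ μ, IsHermiteIMeasure q μ) ∧
    (∀ μ, IsHermiteIMeasure q μ →
      (∀ f : H, ‖f‖ = 1 → ∀ k : ℕ,
        vacuumExpectation (gaussian (𝕜 := 𝕜) q f ^ k) = ((∫ x, x ^ k ∂μ : ℝ) : 𝕜)) ∧
      ∀ n : ℕ, ∫ x, x ^ (2 * n) ∂μ = ∏ k ∈ Finset.range n, qInt q (2 * k + 1)) ∧
    (∀ f : H, ‖f‖ = 1 → ∀ n : ℕ,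
      vacuumExpectation (gaussian (𝕜 := 𝕜) q f ^ (2 * n)) =
        ((∏ k ∈ Finset.range n, qInt q (2 * k + 1) : ℝ) : 𝕜)) ∧
    (∀ n : ℕ, ∏ k ∈ Finset.range n, qInt q (2 * k + 1) =
      ∑ V ∈ pairPartitions (2 * n), (q : ℝ) ^ e0 V) ∧
    (∀ (n : ℕ), ∀ V ∈ pairPartitions (2 * n), (e0 V : ℝ) = (ip V : ℝ) / 2 + (cr V : ℝ)) ∧
    -- the commutation relation
    (∀ f g : H,
      annihilation q f * creation q g - (((q : ℝ) : 𝕜) ^ 2) • (creation q g * annihilation q f) =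
        inner 𝕜 f g • qPowN 𝕜 H q) := by
  have he : ∀ (n : ℕ), ∀ V ∈ pairPartitions (2 * n),
      (e0 V : ℝ) = (ip V : ℝ) / 2 + (cr V : ℝ) := fun n V hV =>
    (mem_pairPartitions.1 hV).e0_eq
  refine ⟨fun n f => ?_, exists_isHermiteIMeasure q,
    fun μ hμ => ⟨fun f hf k => hμ.vacuumExpectation_eq hf k, hμ.integral_pow_two_mul⟩,
    fun f hf n => vacuumExpectation_gaussian_pow q hf n, fun n => ?_, he,
    annihilation_creation_commutation q⟩
  · rw [vacuumExpectation_gaussian_prod]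
    refine Finset.sum_congr rfl fun V hV => ?_
    -- The real exponent is the natural number `e0 V`, so this is an ordinary power, also at `q =
    -- 0`.
    rw [← he n V hV, Real.rpow_natCast, RCLike.ofReal_pow]
  -- A scalar identity, so any unit vector will do: for `1` in `ℝ` all inner products in the Wick
  -- formula are `1`.
  · have h1 := vacuumExpectation_gaussian_pow (𝕜 := ℝ) q (f := (1 : ℝ)) norm_one n
    have h2 := vacuumExpectation_gaussian_prod (𝕜 := ℝ) q fun _ : Fin (2 * n) => (1 : ℝ)
    rw [List.ofFn_const, List.prod_replicate, h1] at h2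
    simpa using h2
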